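/- Let $F$ be a number field with ring of integers $\mathcal O$ and different $\mathfrak D$. Write $e(t)=e^{2\pi i t}$ and let $\psi=\psi_\infty\prod_{v\nmid\infty}\psi_v$ be the standard additive character of $\mathbb A_F/F$, with $\psi_\infty(x)=e(-\mathrm{Tr}_{F_\infty}(x))$ and with $\psi_v$ of conductor $\mathfrak D_v^{-1}$ for every finite place $v$. For a nonzero integral ideal $\mathfrak b$ put $\psi_{\mathfrak b}=\prod_{\mathfrak p_v\mid\mathfrak b}\psi_v$, viewed as a function on $F$, and $\mathfrak D_{\mathfrak b}=\prod_{\mathfrak p_v\mid\mathfrak b}\mathfrak p_v^{\mathrm{ord}_v(\mathfrak D)}$. Let $\mathrm N$ be the ideal norm and $\mu$ the Möbius function on nonzero integral ideals. For nonzero fractional ideals $\mathfrak q\subseteq\mathfrak b$, let $(\mathfrak b/\mathfrak q)^\times$ be the set of $x\in\mathfrak b/\mathfrak q$ that generate $\mathfrak b/\mathfrak q$ as an $\mathcal O$-module, and for such $x$ let $x^{-1}$ be the unique class $y\in(\mathfrak b^{-1}/\mathfrak q\mathfrak b^{-2})^\times$ with $xy\in 1+\mathfrak q\mathfrak b^{-1}$.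 For integral ideals $\mathfrak q\mid\mathfrak b$ and $\alpha,\beta\in F$ with $\mathrm{ord}_v(\alpha)\ge 0$ and $\mathrm{ord}_v(\beta)\ge-2\,\mathrm{ord}_v(\mathfrak q\mathfrak D)$ for all $\mathfrak p_v\mid\mathfrak b$, define the Kloosterman sum $$\mathrm{Kl}_{\mathfrak b}(\alpha,\beta;\mathfrak q)=\sum_{x\in((\mathfrak q\mathfrak D_{\mathfrak b})^{-1}/\mathfrak D_{\mathfrak b}^{-1})^\times}\psi_{\mathfrak b}(\alpha x+\beta x^{-1}).$$ Let $\mathfrak a,\mathfrak c$ be nonzero fractional ideals and $\mathfrak d,\mathfrak q$ nonzero integral ideals such that $(\mathfrak c\mathfrak D)^2(\mathfrak a\mathfrak d)^{-1}=(\beta_{\mathfrak d})$ and $\mathfrak c^{-1}\mathfrak q=(c_{\mathfrak q})$ are principal, with generators $\beta_{\mathfrak d},c_{\mathfrak q}\in F^\times$. Put $\mathfrak b=(\mathfrak d,\mathfrak q)^{-1}\mathfrak q$, let $\mathfrak q_1\mid\mathfrak b$ be an integral ideal, and let $\gamma\in\mathfrak a(\mathfrak b\mathfrak q_1^2\mathfrak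 D^3)^{-1}$. Define $$T_{\mathfrak d}(\gamma;\mathfrak q,\mathfrak q_1)=\sum_{x\in(\mathfrak a\mathfrak d(\mathfrak c\mathfrak D)^{-1}/\mathfrak a\mathfrak d(\mathfrak c\mathfrak D)^{-1}\mathfrak q)^\times}\psi_\infty\Big(\frac{x^{-1}}{\beta_{\mathfrak d}c_{\mathfrak q}}\Big)\,\mathrm{Kl}_{\mathfrak b}(1,-\gamma c_{\mathfrak q}/x;\mathfrak q_1),$$ where $1/x$ is read as the class $x^{-1}$. Let $\breve{\mathfrak q}_1$ be the square-free part of $\mathfrak q_1$ (the product of the primes dividing $\mathfrak q_1$ exactly once). Then $T_{\mathfrak d}(\gamma;\mathfrak q,\mathfrak q_1)=0$ unless $(\mathfrak q_1,\mathfrak q\mathfrak q_1^{-1})=(1)$, in which case $$T_{\mathfrak d}(\gamma;\mathfrak q,\mathfrak q_1)=\psi_{\mathfrak b}(-\beta_{\mathfrak d}c_{\mathfrak q}^2\gamma)\,\mu(\mathfrak q\mathfrak q_1^{-1})\,\mathrm N(\mathfrak q_1)\sum_{\mathfrak q_2,\,\mathfrak f}\frac{\mu(\mathfrak q_1\mathfrak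 q_2^{-1})\mu(\mathfrak f)}{\mathrm N(\mathfrak f)}\,\psi_{\mathfrak f}(\beta_{\mathfrak d}c_{\mathfrak q}^2\gamma),$$ where the sum is over integral ideals $\mathfrak q_2\mid\mathfrak q_1$ and $\mathfrak f\mid\breve{\mathfrak q}_1$ with $(\mathfrak q_2,\mathfrak q\mathfrak q_1^{-1})=(\mathfrak q_2,\mathfrak f)=(1)$ and $\gamma\in\mathfrak a(\mathfrak b\mathfrak q_1\mathfrak q_2\mathfrak f\mathfrak D^3)^{-1}$. -/

import Mathlib

open NumberField IsDedekindDomain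
open scoped nonZeroDivisors

noncomputable section

namespace VoronoiSum

/-- Fractional ideals of the number field `K`. -/
abbrev FracIdeal (K : Type*) [Field K] [NumberField K] := FractionalIdeal (𝓞 K)⁰ K

/-- The different ideal of `K`, as a fractional ideal. -/
def different (K : Type*) [Field K] [NumberField K] : FracIdeal K :=
  ((differentIdeal ℤ (𝓞 K) : Ideal (𝓞 K)) : FractionalIdeal (𝓞 K)⁰ K)

/-! ### The standard additive character -/

open scoped Classical in
/-- The archimedean part of the standard additive character: the product over the real places of
`e(-x)` and over the complex places of `e(-(z + conj z))`, where `e(t) = exp(2πit)`, on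
`K_∞ = ℝ^{r₁} × ℂ^{r₂}`. -/
def psiInf {K : Type*} [Field K] [NumberField K] (x : mixedEmbedding.mixedSpace K) : ℂ :=
  (∏ w : {w : InfinitePlace K // w.IsReal}, (Real.fourierChar (-(x.1 w)) : ℂ)) *
    ∏ w : {w : InfinitePlace K // w.IsComplex},
      (Real.fourierChar (-(x.2 w + (starRingEnd ℂ) (x.2 w)).re) : ℂ)

/-- `k ∈ K` is a polar part at `v` of `x ∈ K_v` if `x - k` is integral at `v` and `k` is integral
at every other finite place. -/
def IsPolarPart {K : Type*} [Field K] [NumberField K] (v : HeightOneSpectrum (𝓞 K))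
    (x : v.adicCompletion K) (k : K) : Prop :=
  Valued.v (x - algebraMap K (v.adicCompletion K) k) ≤ 1 ∧
    ∀ w : HeightOneSpectrum (𝓞 K), w ≠ v → w.valuation K k ≤ 1

theorem valued_algebraMap {K : Type*} [Field K] [NumberField K] (v : HeightOneSpectrum (𝓞 K))
    (k : K) : Valued.v (algebraMap K (v.adicCompletion K) k) = v.valuation K k :=
  v.valuedAdicCompletion_eq_valuation' k

theorem exists_polar_global {K : Type*} [Field K] [NumberField K] (v : HeightOneSpectrum (𝓞 K))
    (k₀ : K) : ∃ k : K, v.valuation K (k₀ - k) ≤ 1 ∧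
    ∀ w : HeightOneSpectrum (𝓞 K), w ≠ v → w.valuation K k ≤ 1 := by
  obtain ⟨a, s, hs, rfl⟩ := IsFractionRing.div_surjective (𝓞 K) k₀
  have hs0 : s ≠ 0 := nonZeroDivisors.ne_zero hs
  have hsK : algebraMap (𝓞 K) K s ≠ 0 := by simpa using hs0
  have hfin : FiniteMultiplicity v.asIdeal (Ideal.span {s}) :=
    FiniteMultiplicity.of_prime_left v.prime (by simpa using hs0)
  obtain ⟨J, hJ, hvJ⟩ := hfin.exists_eq_pow_mul_and_not_dvd
  set n := multiplicity v.asIdeal (Ideal.span {s})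
  have hcop : IsCoprime (v.asIdeal ^ n) J := by
    apply IsCoprime.pow_left
    rw [Ideal.isCoprime_iff_sup_eq]
    by_contra h
    apply hvJ
    rw [Ideal.dvd_iff_le]
    have := v.isMaximal.eq_of_le h le_sup_left
    rw [this]
    exact le_sup_right
  obtain ⟨t, ht, e, he, hte⟩ := Ideal.isCoprime_iff_exists.1 hcop
  have hsn : WithZero.exp (-(n : ℤ)) ≤ v.intValuation s := by
    rw [v.intValuation_eq_exp_neg_multiplicity hs0]
  refine ⟨algebraMap (𝓞 K) K a / algebraMap (𝓞 K) K s * algebraMap (𝓞 K) K e, ?_, ?_⟩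
  · have h1 : algebraMap (𝓞 K) K a / algebraMap (𝓞 K) K s -
        algebraMap (𝓞 K) K a / algebraMap (𝓞 K) K s * algebraMap (𝓞 K) K e =
        algebraMap (𝓞 K) K a * algebraMap (𝓞 K) K t / algebraMap (𝓞 K) K s := by
      have : algebraMap (𝓞 K) K t = 1 - algebraMap (𝓞 K) K e := by
        rw [← map_one (algebraMap (𝓞 K) K), ← hte, map_add]; ring
      rw [this]; ring
    rw [h1, map_div₀, map_mul, v.valuation_of_algebraMap, v.valuation_of_algebraMap,
      v.valuation_of_algebraMap]
    apply div_le_one_of_le₀ _ (zero_le)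
    calc v.intValuation a * v.intValuation t ≤ 1 * WithZero.exp (-(n : ℤ)) :=
          mul_le_mul' (v.intValuation_le_one a) ((v.intValuation_le_pow_iff_mem t n).2 ht)
      _ ≤ v.intValuation s := by rwa [one_mul]
  · intro w hw
    obtain ⟨p, hp, hpw⟩ : ∃ p ∈ v.asIdeal ^ n, p ∉ w.asIdeal := by
      by_contra! h
      have h2 : v.asIdeal ≤ w.asIdeal := w.isPrime.le_of_pow_le h
      exact hw (HeightOneSpectrum.ext (v.isMaximal.eq_of_le w.isPrime.ne_top h2).symm)
    have hpe : p * e ∈ Ideal.span {s} := by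
      rw [hJ]; exact Ideal.mul_mem_mul hp he
    obtain ⟨r, hr⟩ := Ideal.mem_span_singleton'.1 hpe
    have hval : w.valuation K (algebraMap (𝓞 K) K p) = 1 := by
      rw [HeightOneSpectrum.valuation_eq_one_iff_notMem]; exact hpw
    have hmul : algebraMap (𝓞 K) K a / algebraMap (𝓞 K) K s * algebraMap (𝓞 K) K e *
        algebraMap (𝓞 K) K p = algebraMap (𝓞 K) K (a * r) := by
      have := congrArg (algebraMap (𝓞 K) K) hr
      rw [map_mul, map_mul] at this
      rw [map_mul]
      field_simp
      linear_combination -(algebraMap (𝓞 K) K a) * this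
    have := w.valuation_le_one (K := K) (a * r)
    change w.valuation K (algebraMap (𝓞 K) K (a * r)) ≤ 1 at this
    rwa [← hmul, map_mul, hval, mul_one] at this

theorem exists_isPolarPart {K : Type*} [Field K] [NumberField K] (v : HeightOneSpectrum (𝓞 K))
    (x : v.adicCompletion K) : ∃ k : K, IsPolarPart v x k := by
  have hopen : IsOpen {y : v.adicCompletion K | x - y ∈ v.adicCompletionIntegers K} :=
    (Valued.isOpen_valuationSubring _).preimage (continuous_const.sub continuous_id)
  obtain ⟨k₀, hk₀⟩ := (HeightOneSpectrum.denseRange_algebraMap K v).exists_mem_open hopen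
    ⟨x, by simp⟩
  obtain ⟨k, hk, hk'⟩ := exists_polar_global v k₀
  refine ⟨k, ?_, hk'⟩
  have h : x - algebraMap K (v.adicCompletion K) k =
      (x - algebraMap K (v.adicCompletion K) k₀) +
        algebraMap K (v.adicCompletion K) (k₀ - k) := by
    rw [map_sub]; ring
  rw [h]
  refine (Valued.v.map_add _ _).trans (max_le ?_ ?_)
  · exact hk₀
  · rwa [valued_algebraMap]

theorem fourierChar_trace_eq_one {K : Type*} [Field K] [NumberField K] (k : K)
    (h : ∀ w : HeightOneSpectrum (𝓞 K), w.valuation K k ≤ 1) :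
    Real.fourierChar ((Algebra.trace ℚ K k : ℚ) : ℝ) = 1 := by
  obtain ⟨a, rfl⟩ := HeightOneSpectrum.mem_integers_of_valuation_le_one (R := 𝓞 K) K k h
  have hi : IsIntegral ℤ (Algebra.trace ℚ K (algebraMap (𝓞 K) K a)) :=
    Algebra.isIntegral_trace (RingOfIntegers.isIntegral_coe a)
  obtain ⟨m, hm⟩ := IsIntegrallyClosed.isIntegral_iff.1 hi
  rw [← hm]
  ext
  simp [Real.fourierChar_apply, Complex.exp_eq_one_iff]
  exact ⟨m, by ring⟩

theorem fourierChar_trace_eq {K : Type*} [Field K] [NumberField K] {v : HeightOneSpectrum (𝓞 K)}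
    {x : v.adicCompletion K} {k k' : K} (h : IsPolarPart v x k) (h' : IsPolarPart v x k') :
    Real.fourierChar ((Algebra.trace ℚ K k : ℚ) : ℝ) =
      Real.fourierChar ((Algebra.trace ℚ K k' : ℚ) : ℝ) := by
  have key := fourierChar_trace_eq_one (k - k') (fun w => ?_)
  · rw [map_sub, Rat.cast_sub, AddChar.map_sub_eq_div, div_eq_one] at key
    exact key
  · by_cases hw : w = v
    · subst hw
      rw [← valued_algebraMap]
      have : algebraMap K (w.adicCompletion K) (k - k') =
          (x - algebraMap K (w.adicCompletion K) k') -
            (x - algebraMap K (w.adicCompletion K) k) := by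
        rw [map_sub]; ring
      rw [this]
      exact (Valued.v.map_sub _ _).trans (max_le h'.1 h.1)
    · exact ((w.valuation K).map_sub _ _).trans (max_le (h.2 w hw) (h'.2 w hw))

/-- The standard additive character `ψ_v` of the completion `K_v` at a finite place `v`.
The standard character `ψ = ψ_∞ ∏_v ψ_v` of the adeles is trivial on `K`, its finite components are
trivial on the local integers (as they are trivial on the inverse different), and
`ψ_∞(x) = e(-Tr x)`. If `k ∈ K` is a polar part of `x` at `v`
(see `IsPolarPart`; it exists by `exists_isPolarPart`), evaluating `ψ` at the principal adele `k`
therefore gives `ψ_v(x) = ψ_v(k) = ψ_∞(k)⁻¹ = e(Tr k)`. This is the definition used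
here; it does not depend on the choice of `k` by `fourierChar_trace_eq`, and
`psiInf_mixedEmbedding` and `finprod_psiLoc` confirm that `ψ` is trivial on `K`. -/
def psiLoc {K : Type*} [Field K] [NumberField K] (v : HeightOneSpectrum (𝓞 K)) :
    AddChar (v.adicCompletion K) Circle where
  toFun x := Real.fourierChar ((Algebra.trace ℚ K (exists_isPolarPart v x).choose : ℚ) : ℝ)
  map_zero_eq_one' := by
    rw [fourierChar_trace_eq (exists_isPolarPart v 0).choose_spec (k' := 0)
      ⟨by simp, by simp⟩]
    simp
  map_add_eq_mul' x y := by
    have hx := (exists_isPolarPart v x).choose_spec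
    have hy := (exists_isPolarPart v y).choose_spec
    rw [fourierChar_trace_eq (exists_isPolarPart v (x + y)).choose_spec
      (k' := (exists_isPolarPart v x).choose + (exists_isPolarPart v y).choose) ⟨?_, ?_⟩]
    · rw [map_add, Rat.cast_add, AddChar.map_add_eq_mul]
    · rw [map_add, add_sub_add_comm]
      exact (Valued.v.map_add _ _).trans (max_le hx.1 hy.1)
    · intro w hw
      exact ((w.valuation K).map_add _ _).trans (max_le (hx.2 w hw) (hy.2 w hw))

theorem psiLoc_eq {K : Type*} [Field K] [NumberField K] {v : HeightOneSpectrum (𝓞 K)}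
    {x : v.adicCompletion K} {k : K} (h : IsPolarPart v x k) :
    psiLoc v x = Real.fourierChar ((Algebra.trace ℚ K k : ℚ) : ℝ) :=
  fourierChar_trace_eq (exists_isPolarPart v x).choose_spec h

theorem fourierChar_sum {ι : Type*} (s : Finset ι) (f : ι → ℝ) :
    Real.fourierChar (∑ i ∈ s, f i) = ∏ i ∈ s, Real.fourierChar (f i) := by
  classical
  induction s using Finset.induction_on with
  | empty => simp
  | insert a s ha ih => rw [Finset.sum_insert ha, Finset.prod_insert ha, AddChar.map_add_eq_mul, ih]

theorem circle_coe_prod {ι : Type*} (s : Finset ι) (f : ι → Circle) :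
    ((∏ i ∈ s, f i : Circle) : ℂ) = ∏ i ∈ s, (f i : ℂ) :=
  map_prod Circle.coeHom f s

/-- On `K` the archimedean part is `e(-Tr x)`. -/
theorem psiInf_mixedEmbedding {K : Type*} [Field K] [NumberField K] (x : K) :
    psiInf (mixedEmbedding K x) =
      (Real.fourierChar (-((Algebra.trace ℚ K x : ℚ) : ℝ)) : ℂ) := by
  classical
  have htr : ((Algebra.trace ℚ K x : ℚ) : ℝ) =
      ∑ w : InfinitePlace K, (w.mult : ℝ) * (w.embedding x).re := by
    have h := congrArg Complex.re (trace_eq_sum_embeddings (K := ℚ) (E := ℂ) (x := x))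
    rw [eq_ratCast, Complex.ratCast_re, Complex.re_sum,
      ← Fintype.sum_equiv (RingHom.equivRatAlgHom K ℂ) (fun f => (f x).re)
      (fun φ => (φ x).re) fun _ => by simp [RingHom.equivRatAlgHom_apply]] at h
    rw [h, ← Finset.sum_fiberwise Finset.univ InfinitePlace.mk (fun φ => (φ x).re)]
    refine Finset.sum_congr rfl fun w _ => ?_
    have (φ) (hφ : φ ∈ ({φ | InfinitePlace.mk φ = w} : Finset (K →+* ℂ))) :
        (φ x).re = (w.embedding x).re := by
      have := (Finset.mem_filter.mp hφ).2
      rw [← InfinitePlace.mk_embedding w, InfinitePlace.mk_eq_iff] at this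
      rcases this with h | h
      · rw [h]
      · rw [← h]; simp
    rw [Finset.sum_congr rfl this, Finset.sum_const, InfinitePlace.card_filter_mk_eq, nsmul_eq_mul]
  have key : Real.fourierChar (-((Algebra.trace ℚ K x : ℚ) : ℝ)) =
      ∏ w : InfinitePlace K, Real.fourierChar (-((w.mult : ℝ) * (w.embedding x).re)) := by
    rw [htr, ← Finset.sum_neg_distrib]
    exact fourierChar_sum _ _
  rw [key, InfinitePlace.prod_eq_prod_mul_prod, psiInf]
  rw [Circle.coe_mul]
  rw [circle_coe_prod, circle_coe_prod]
  congr 1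
  · refine Finset.prod_congr (by congr) fun w _ => ?_
    rw [mixedEmbedding.mixedEmbedding_apply_isReal, InfinitePlace.mult_isReal, Nat.cast_one, one_mul]
    congr 3
  · refine Finset.prod_congr (by congr) fun w _ => ?_
    rw [mixedEmbedding.mixedEmbedding_apply_isComplex, InfinitePlace.mult_isComplex]
    congr 3
    simp; ring

theorem finite_not_integral {K : Type*} [Field K] [NumberField K] (x : K) :
    {v : HeightOneSpectrum (𝓞 K) | ¬ v.valuation K x ≤ 1}.Finite := by
  obtain ⟨a, s, hs, rfl⟩ := IsFractionRing.div_surjective (𝓞 K) x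
  have hs0 : s ≠ 0 := nonZeroDivisors.ne_zero hs
  refine (Ideal.finite_factors (I := Ideal.span {s}) (by simpa using hs0)).subset ?_
  intro v hv
  by_contra h
  apply hv
  have : s ∉ v.asIdeal := fun h' => h (by
    rw [Set.mem_ofPred_eq, Ideal.dvd_span_singleton]; exact h')
  have h1 : v.valuation K (algebraMap (𝓞 K) K s) = 1 := by
    rw [HeightOneSpectrum.valuation_eq_one_iff_notMem]; exact this
  rw [map_div₀, h1, div_one]
  exact v.valuation_le_one a

/-- The finite components multiply to `e(Tr x)` on `K`: the character `ψ_∞ ∏_v ψ_v` is trivial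
on `K`. -/
theorem finprod_psiLoc {K : Type*} [Field K] [NumberField K] (x : K) :
    ∏ᶠ v : HeightOneSpectrum (𝓞 K), psiLoc v (algebraMap K (v.adicCompletion K) x) =
      Real.fourierChar ((Algebra.trace ℚ K x : ℚ) : ℝ) := by
  classical
  choose k hk using fun v : HeightOneSpectrum (𝓞 K) =>
    exists_isPolarPart v (algebraMap K (v.adicCompletion K) x)
  set S := (finite_not_integral x).toFinset
  have h1 : ∀ v ∉ S, psiLoc v (algebraMap K (v.adicCompletion K) x) = 1 := by
    intro v hv
    have hv : v.valuation K x ≤ 1 := by simpa [S] using hv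
    have : IsPolarPart v (algebraMap K (v.adicCompletion K) x) 0 :=
      ⟨by simpa [valued_algebraMap] using hv, by simp⟩
    rw [psiLoc_eq this]; simp
  rw [finprod_eq_prod_of_mulSupport_subset (s := S) _ (fun v hv => by
    by_contra h; exact hv (h1 v h)), Finset.prod_congr rfl fun v _ => psiLoc_eq (hk v),
    ← fourierChar_sum, ← Rat.cast_sum, ← map_sum, eq_comm, ← div_eq_one,
    ← AddChar.map_sub_eq_div, ← Rat.cast_sub, ← map_sub]
  apply fourierChar_trace_eq_one
  intro w
  by_cases hw : w ∈ S
  · rw [← Finset.add_sum_erase _ _ hw, ← sub_sub]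
    refine ((w.valuation K).map_sub _ _).trans (max_le ?_ ?_)
    · rw [← valued_algebraMap, map_sub]; exact (hk w).1
    · exact (w.valuation K).map_sum_le fun v hv => (hk v).2 w (Finset.ne_of_mem_erase hv).symm
  · refine ((w.valuation K).map_sub _ _).trans (max_le (by simpa [S] using hw) ?_)
    exact (w.valuation K).map_sum_le fun v hv => (hk v).2 w (by rintro rfl; exact hw hv)
/-- For a nonzero integral ideal `𝔟`, the value at `x ∈ K` of `ψ_𝔟 = ∏_{𝔭_v ∣ 𝔟} ψ_v`. -/
def psiIdeal {K : Type*} [Field K] [NumberField K] (𝔟 : Ideal (𝓞 K)) (x : K) : ℂ :=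
  ∏ᶠ (v : HeightOneSpectrum (𝓞 K)) (_ : v.asIdeal ∣ 𝔟),
    (psiLoc v (algebraMap K (v.adicCompletion K) x) : ℂ)

/-! ### Unit classes modulo an ideal and their inverses -/

/-- The `𝓞 K`-module `𝔟 / 𝔮`, for fractional ideals `𝔮 ⊆ 𝔟`. -/
abbrev IdealQuotient {K : Type*} [Field K] [NumberField K] (𝔟 𝔮 : FracIdeal K) :=
  (𝔟 : Submodule (𝓞 K) K) ⧸ (𝔮 : Submodule (𝓞 K) K).submoduleOf (𝔟 : Submodule (𝓞 K) K)

/-- `(𝔟 / 𝔮)^×`: the classes that generate `𝔟 / 𝔮` as an `𝓞 K`-module. -/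
def unitClasses {K : Type*} [Field K] [NumberField K] (𝔟 𝔮 : FracIdeal K) :
    Set (IdealQuotient 𝔟 𝔮) :=
  {X | Submodule.span (𝓞 K) {X} = ⊤}

/-- A representative in `K` of a class in `𝔟 / 𝔮`. -/
def rep {K : Type*} [Field K] [NumberField K] {𝔟 𝔮 : FracIdeal K} (X : IdealQuotient 𝔟 𝔮) : K :=
  ((Submodule.mkQ_surjective _ X).choose : (𝔟 : Submodule (𝓞 K) K))

/-- `Y ∈ (𝔟⁻¹ / 𝔮𝔟⁻²)^×` is the inverse of `X ∈ 𝔟 / 𝔮` if `x y ∈ 1 + 𝔮𝔟⁻¹` for all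
representatives `x` of `X` and `y` of `Y`. -/
def IsInverseClass {K : Type*} [Field K] [NumberField K] {𝔟 𝔮 : FracIdeal K}
    (X : IdealQuotient 𝔟 𝔮) (Y : IdealQuotient 𝔟⁻¹ (𝔮 * (𝔟⁻¹) ^ 2)) : Prop :=
  Y ∈ unitClasses 𝔟⁻¹ (𝔮 * (𝔟⁻¹) ^ 2) ∧
    ∀ (x : (𝔟 : Submodule (𝓞 K) K)) (y : ((𝔟⁻¹ : FracIdeal K) : Submodule (𝓞 K) K)),
      Submodule.Quotient.mk x = X → Submodule.Quotient.mk y = Y →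
        (x : K) * (y : K) - 1 ∈ 𝔮 * 𝔟⁻¹

theorem mk_eq_mk_iff {K : Type*} [Field K] [NumberField K] {𝔟 𝔮 : FracIdeal K}
    (x y : (𝔟 : Submodule (𝓞 K) K)) :
    (Submodule.Quotient.mk x : IdealQuotient 𝔟 𝔮) = Submodule.Quotient.mk y ↔
      (x : K) - (y : K) ∈ 𝔮 :=
  Submodule.Quotient.eq _

theorem existsUnique_inverseClass {K : Type*} [Field K] [NumberField K] {𝔟 𝔮 : FracIdeal K}
    (h𝔟 : 𝔟 ≠ 0) {X : IdealQuotient 𝔟 𝔮} (hX : X ∈ unitClasses 𝔟 𝔮) :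
    ∃! Y : IdealQuotient 𝔟⁻¹ (𝔮 * (𝔟⁻¹) ^ 2), IsInverseClass X Y := by
  obtain ⟨x, rfl⟩ := Submodule.mkQ_surjective _ X
  have hgen : ∀ u ∈ 𝔟, ∃ r : 𝓞 K, u - r • (x : K) ∈ 𝔮 := by
    intro u hu
    have hmem : Submodule.Quotient.mk (⟨u, hu⟩ : (𝔟 : Submodule (𝓞 K) K)) ∈
        Submodule.span (𝓞 K) {(Submodule.Quotient.mk x : IdealQuotient 𝔟 𝔮)} := by
      have : Submodule.span (𝓞 K) {(Submodule.Quotient.mk x : IdealQuotient 𝔟 𝔮)} = ⊤ := hX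
      rw [this]; trivial
    obtain ⟨r, hr⟩ := Submodule.mem_span_singleton.1 hmem
    rw [← Submodule.Quotient.mk_smul, eq_comm, Submodule.Quotient.eq] at hr
    exact ⟨r, hr⟩
  have hle : 𝔟 ≤ FractionalIdeal.spanSingleton (𝓞 K)⁰ (x : K) + 𝔮 := by
    intro u hu
    obtain ⟨r, hr⟩ := hgen u hu
    rw [FractionalIdeal.mem_add]
    exact ⟨r • (x : K), (FractionalIdeal.mem_spanSingleton _).2 ⟨r, rfl⟩, _, hr, by ring⟩
  have hone : (1 : K) ∈ FractionalIdeal.spanSingleton (𝓞 K)⁰ (x : K) * 𝔟⁻¹ + 𝔮 * 𝔟⁻¹ := by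
    rw [← add_mul]
    have h1 : (1 : FracIdeal K) ≤ (FractionalIdeal.spanSingleton (𝓞 K)⁰ (x : K) + 𝔮) * 𝔟⁻¹ := by
      rw [← mul_inv_cancel₀ h𝔟]
      exact mul_le_mul_left hle _
    exact h1 (FractionalIdeal.one_mem_one _)
  obtain ⟨_, h1, z, hz, hsum⟩ := FractionalIdeal.mem_add _ _ _ |>.1 hone
  obtain ⟨y, hy, rfl⟩ := FractionalIdeal.mem_singleton_mul.1 h1
  have hB : 𝔟 * 𝔟⁻¹ = 1 := mul_inv_cancel₀ h𝔟
  have hQ1 : 𝔮 * (𝔟⁻¹) ^ 2 = 𝔟⁻¹ * (𝔮 * 𝔟⁻¹) := by ring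
  have hQ2 : 𝔟 * (𝔮 * (𝔟⁻¹) ^ 2) = 𝔮 * 𝔟⁻¹ := by
    calc 𝔟 * (𝔮 * (𝔟⁻¹) ^ 2) = (𝔟 * 𝔟⁻¹) * (𝔮 * 𝔟⁻¹) := by ring
      _ = 𝔮 * 𝔟⁻¹ := by rw [hB, one_mul]
  refine ⟨Submodule.Quotient.mk ⟨y, hy⟩, ⟨?_, ?_⟩, ?_⟩
  · refine eq_top_iff.2 fun U _ => ?_
    obtain ⟨u, rfl⟩ := Submodule.mkQ_surjective _ U
    have hux : (u : K) * x ∈ (1 : FracIdeal K) := by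
      rw [← hB, mul_comm 𝔟]
      exact FractionalIdeal.mul_mem_mul u.2 x.2
    obtain ⟨r, hr⟩ := (FractionalIdeal.mem_one_iff _).1 hux
    refine Submodule.mem_span_singleton.2 ⟨r, ?_⟩
    rw [← Submodule.Quotient.mk_smul, Submodule.mkQ_apply, eq_comm, Submodule.Quotient.eq]
    change (u : K) - r • y ∈ 𝔮 * (𝔟⁻¹) ^ 2
    have : (u : K) - r • y = u * z := by
      rw [Algebra.smul_def, hr]
      linear_combination -(u : K) * hsum
    rw [this, hQ1]
    exact FractionalIdeal.mul_mem_mul u.2 hz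
  · intro x' y' hx' hy'
    have hx2 : (x' : K) - x ∈ 𝔮 := (mk_eq_mk_iff x' x).1 hx'
    have hy2 : (y' : K) - y ∈ 𝔮 * (𝔟⁻¹) ^ 2 := (mk_eq_mk_iff y' ⟨y, hy⟩).1 hy'
    have : (x' : K) * y' - 1 = -z + (((x' : K) - x) * y' + x * ((y' : K) - y)) := by
      linear_combination hsum
    rw [this]
    have h3 : (x : K) * ((y' : K) - y) ∈ 𝔮 * 𝔟⁻¹ := by
      rw [← hQ2]; exact FractionalIdeal.mul_mem_mul x.2 hy2
    exact Submodule.add_mem _ (Submodule.neg_mem _ hz)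
      (Submodule.add_mem _ (FractionalIdeal.mul_mem_mul hx2 y'.2) h3)
  · rintro Y ⟨-, hY⟩
    obtain ⟨y', rfl⟩ := Submodule.mkQ_surjective _ Y
    have h := hY x y' rfl rfl
    rw [Submodule.mkQ_apply, Submodule.Quotient.eq]
    change (y' : K) - y ∈ 𝔮 * (𝔟⁻¹) ^ 2
    have : (y' : K) - y = y * ((x : K) * y' - 1) + y' * z := by
      linear_combination -(y' : K) * hsum
    rw [this, hQ1]
    exact Submodule.add_mem _ (FractionalIdeal.mul_mem_mul hy h)
      (FractionalIdeal.mul_mem_mul y'.2 hz)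

open scoped Classical in
/-- The inverse `X⁻¹ ∈ (𝔟⁻¹ / 𝔮𝔟⁻²)^×` of a class `X ∈ (𝔟 / 𝔮)^×`; it exists and is unique by
`existsUnique_inverseClass`. -/
def invClass {K : Type*} [Field K] [NumberField K] {𝔟 𝔮 : FracIdeal K}
    (X : IdealQuotient 𝔟 𝔮) : IdealQuotient 𝔟⁻¹ (𝔮 * (𝔟⁻¹) ^ 2) :=
  if h : ∃ Y, IsInverseClass X Y then h.choose else 0

/-! ### Arithmetic of ideals -/

open scoped Classical in
/-- The exact quotient `I J⁻¹` of integral ideals, when `J` divides `I` (and `0` otherwise). -/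
def idealDiv {K : Type*} [Field K] [NumberField K] (I J : Ideal (𝓞 K)) : Ideal (𝓞 K) :=
  if h : J ∣ I then h.choose else 0

open scoped Classical in
/-- The Möbius function on the nonzero ideals of `𝓞 K`. -/
def idealMoebius {K : Type*} [Field K] [NumberField K] (I : Ideal (𝓞 K)) : ℤ :=
  if Squarefree I then (-1) ^ (UniqueFactorizationMonoid.normalizedFactors I).card else 0

/-- The square-free part of an ideal: the product of the primes that divide it exactly once. -/
def squarefreePart {K : Type*} [Field K] [NumberField K] (I : Ideal (𝓞 K)) : Ideal (𝓞 K) :=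
  ∏ᶠ (v : HeightOneSpectrum (𝓞 K)) (_ : v.asIdeal ∣ I ∧ ¬ v.asIdeal ^ 2 ∣ I), v.asIdeal

/-- The part `𝔞_𝔟 = ∏_{𝔭_v ∣ 𝔟} 𝔭_v ^ ord_v(𝔞)` of a fractional ideal `𝔞` supported at the primes
dividing the nonzero integral ideal `𝔟`. -/
def partAt {K : Type*} [Field K] [NumberField K] (𝔞 : FracIdeal K) (𝔟 : Ideal (𝓞 K)) :
    FracIdeal K :=
  ∏ᶠ (v : HeightOneSpectrum (𝓞 K)) (_ : v.asIdeal ∣ 𝔟),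
    ((v.asIdeal : Ideal (𝓞 K)) : FracIdeal K) ^ FractionalIdeal.count K v 𝔞

/-! ### The exponential sums -/

/-- The Kloosterman sum
`Kl_𝔟(α, β; 𝔮) = ∑_{x ∈ ((𝔮𝔇_𝔟)⁻¹ / 𝔇_𝔟⁻¹)^×} ψ_𝔟(α x + β x⁻¹)`, for `𝔮 ∣ 𝔟`. -/
def kloosterman {K : Type*} [Field K] [NumberField K] (𝔟 : Ideal (𝓞 K)) (α β : K)
    (𝔮 : Ideal (𝓞 K)) : ℂ :=
  ∑ᶠ X ∈ unitClasses ((𝔮 : FracIdeal K) * partAt (different K) 𝔟)⁻¹ (partAt (different K) 𝔟)⁻¹,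
    psiIdeal 𝔟 (α * rep X + β * rep (invClass X))

/-- The modulus `𝔟 = (𝔡, 𝔮)⁻¹ 𝔮`. -/
def modulus {K : Type*} [Field K] [NumberField K] (𝔡 𝔮 : Ideal (𝓞 K)) : Ideal (𝓞 K) :=
  idealDiv 𝔮 (𝔡 ⊔ 𝔮)

/-- The exponential sum
`T_𝔡(γ; 𝔮, 𝔮₁) = ∑_x ψ_∞(x⁻¹ / (β c)) Kl_𝔟(1, -γ c / x; 𝔮₁)`, where `x` runs over
`(𝔞𝔡(𝔠𝔇)⁻¹ / 𝔞𝔡(𝔠𝔇)⁻¹𝔮)^×`, `𝔟 = (𝔡, 𝔮)⁻¹ 𝔮`, and `β`, `c` are generators of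
`(𝔠𝔇)²(𝔞𝔡)⁻¹` and `𝔠⁻¹𝔮`. -/
def expSum {K : Type*} [Field K] [NumberField K] (𝔞 𝔠 : FracIdeal K) (𝔡 : Ideal (𝓞 K)) (β c γ : K)
    (𝔮 𝔮₁ : Ideal (𝓞 K)) : ℂ :=
  ∑ᶠ X ∈ unitClasses (𝔞 * (𝔡 : FracIdeal K) * (𝔠 * different K)⁻¹)
      (𝔞 * (𝔡 : FracIdeal K) * (𝔠 * different K)⁻¹ * (𝔮 : FracIdeal K)),
    psiInf (mixedEmbedding K (rep (invClass X) / (β * c))) *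
      kloosterman (modulus 𝔡 𝔮) 1 (-γ * c * rep (invClass X)) 𝔮₁

end VoronoiSum
end

noncomputable section

namespace VoronoiSum

/-! ### Divisors and the Möbius function for ideals -/

section IdealArithmetic

variable {K : Type*} [Field K] [NumberField K]

/-! Both families of unit classes are moved into the single torsion module `K / 𝔇⁻¹`, on which `e(Tr
x)` is a well-defined and nondegenerate character. The `k`-torsion there is cyclic, isomorphic to `𝓞
/ k`, and a class is a unit class exactly when its annihilator is the full modulus. Division by `β
c` makes the inverses of the outer variable the elements `Y` with annihilator `𝔮`
(`bijOn_invClass`), and the Kloosterman variable becomes an element `X` with annihilator `𝔮₁`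
(`bijOn_rep`).

Put `δ = β c² γ` and `b = modulus 𝔡 𝔮`. For each `X` with representative `x` there is an integer `w`
that approximates `δ x⁻¹` at the primes dividing `b` and is small at all others, so that the product
formula for `ψ` turns the Kloosterman sum at `Y` into the sum over `X` of `e(Tr X) e(-Tr wY)`. As
`w` does not depend on `Y`, the sums can be exchanged (`expSum_eq`). The sum over `Y` is then a
Ramanujan sum at `-(1 + w)`: the sum of `μ(𝔮/k) N(k)` over the `k ∣ 𝔮` containing `1 + w`.

Every prime dividing `𝔮/𝔮₁` contains `w`, so it cannot divide such a `k`. If it also divides `𝔮₁`,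
then its square divides `𝔮/k` and all terms vanish (`ramanujan_eq_zero`). If `𝔮₁` and `𝔮/𝔮₁` are
coprime, then `k ∣ 𝔮₁` and a factor `μ(𝔮/𝔮₁)` splits off (`ramanujan_eq_of_isCoprime`).

In the coprime case `w X` is one fixed class `Δ`, the part of `δ` at the primes of `𝔮₁`
(`IsMultiplier.smul_mk`), and `1 + w ∈ g` says that `X + Δ` is killed by `f = 𝔮₁/g`. Möbius
inversion removes the condition on the annihilator of `X`. What remains, for `k, f ∣ 𝔮₁`, is the sum
of `e(Tr X)` over `X` killed by `k` with `X + Δ` killed by `f`. Translation by the common torsion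
kills it unless `k` and `f` are coprime. In that case the Chinese remainder theorem leaves at most
one `X`, which exists exactly when `Δ` is killed by `k f`, and its character value is `ψ_b(-δ)
ψ_f(δ)`. This torsion condition is the membership condition on `γ`, with `𝔮₂ = k`, and the Möbius
factors vanish unless `f` divides the square-free part of `𝔮₁`. -/

theorem finite_ideal_dvd {a : Ideal (𝓞 K)} (ha : a ≠ ⊥) : {h : Ideal (𝓞 K) | h ∣ a}.Finite := by
  have := UniqueFactorizationMonoid.fintypeSubtypeDvd a ha
  exact Set.finite_coe_iff.1 (Finite.of_fintype {h // h ∣ a})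

/-- The divisors of a nonzero ideal. -/
def idealDivisors (a : Ideal (𝓞 K)) : Finset (Ideal (𝓞 K)) :=
  open scoped Classical in if ha : a ≠ ⊥ then (finite_ideal_dvd ha).toFinset else ∅

theorem mem_idealDivisors {a h : Ideal (𝓞 K)} (ha : a ≠ ⊥) : h ∈ idealDivisors a ↔ h ∣ a := by
  simp [idealDivisors, ha]

theorem idealDiv_mul_cancel {I J : Ideal (𝓞 K)} (h : J ∣ I) : J * idealDiv I J = I := by
  rw [idealDiv, dif_pos h]; exact h.choose_spec.symm

theorem idealDiv_eq_of_mul_eq {I J L : Ideal (𝓞 K)} (hJ : J ≠ ⊥) (h : J * L = I) :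
    idealDiv I J = L :=
  mul_left_cancel₀ hJ ((idealDiv_mul_cancel (Dvd.intro _ h)).trans h.symm)

theorem ne_bot_of_dvd {R : Type*} [CommSemiring R] {I J : Ideal R} (hI : I ≠ ⊥) (h : J ∣ I) : J ≠ ⊥ := by
  rintro rfl; exact hI (zero_dvd_iff.1 h)

theorem idealDiv_dvd {I J : Ideal (𝓞 K)} (h : J ∣ I) : idealDiv I J ∣ I :=
  Dvd.intro_left _ (idealDiv_mul_cancel h)

theorem idealDiv_idealDiv {I J : Ideal (𝓞 K)} (hI : I ≠ ⊥) (h : J ∣ I) :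
    idealDiv I (idealDiv I J) = J :=
  idealDiv_eq_of_mul_eq (ne_bot_of_dvd hI (idealDiv_dvd h))
    (by rw [mul_comm, idealDiv_mul_cancel h])

/-- `h ↦ a / h` permutes the divisors of `a`. -/
theorem sum_idealDivisors_idealDiv {a : Ideal (𝓞 K)} (ha : a ≠ ⊥) {M : Type*} [AddCommMonoid M]
    (f : Ideal (𝓞 K) → M) :
    ∑ h ∈ idealDivisors a, f (idealDiv a h) = ∑ h ∈ idealDivisors a, f h := by
  refine Finset.sum_nbij' (idealDiv a) (idealDiv a) ?_ ?_ ?_ ?_ ?_ <;> intro h hh <;>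
    rw [mem_idealDivisors ha] at hh
  · exact (mem_idealDivisors ha).2 (idealDiv_dvd hh)
  · exact (mem_idealDivisors ha).2 (idealDiv_dvd hh)
  · exact idealDiv_idealDiv ha hh
  · exact idealDiv_idealDiv ha hh

theorem idealMoebius_one : idealMoebius (1 : Ideal (𝓞 K)) = 1 := by
  rw [idealMoebius, if_pos squarefree_one, UniqueFactorizationMonoid.normalizedFactors_one]
  simp

theorem idealMoebius_of_not_squarefree {a : Ideal (𝓞 K)} (h : ¬ Squarefree a) :
    idealMoebius a = 0 := if_neg h

theorem idealMoebius_eq_zero_of_sq_dvd {a p : Ideal (𝓞 K)} (hp : Prime p) (h : p ^ 2 ∣ a) :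
    idealMoebius a = 0 :=
  idealMoebius_of_not_squarefree fun hs => hp.not_isUnit (hs p (by rwa [← sq]))

theorem idealMoebius_mul {a b : Ideal (𝓞 K)} (h : IsCoprime a b) :
    idealMoebius (a * b) = idealMoebius a * idealMoebius b := by
  have hrel : IsRelPrime a b := h.isRelPrime
  by_cases hs : Squarefree (a * b)
  · have ha : Squarefree a := hs.squarefree_of_dvd (dvd_mul_right a b)
    have hb : Squarefree b := hs.squarefree_of_dvd (dvd_mul_left b a)
    rw [idealMoebius, idealMoebius, idealMoebius, if_pos hs, if_pos ha, if_pos hb,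
      UniqueFactorizationMonoid.normalizedFactors_mul ha.ne_zero hb.ne_zero, Multiset.card_add,
      pow_add]
  · rw [idealMoebius_of_not_squarefree hs]
    have : ¬ (Squarefree a ∧ Squarefree b) := fun h' =>
      hs ((squarefree_mul_iff).2 ⟨hrel, h'.1, h'.2⟩)
    by_cases ha : Squarefree a
    · rw [idealMoebius_of_not_squarefree fun hb => this ⟨ha, hb⟩, mul_zero]
    · rw [idealMoebius_of_not_squarefree ha, zero_mul]

theorem idealMoebius_prime {p : Ideal (𝓞 K)} (hp : Prime p) : idealMoebius p = -1 := by
  rw [idealMoebius, if_pos hp.irreducible.squarefree,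
    UniqueFactorizationMonoid.normalizedFactors_irreducible hp.irreducible]
  simp

theorem isCoprime_of_prime_not_dvd {p a : Ideal (𝓞 K)} (hp : Prime p) (h : ¬ p ∣ a) :
    IsCoprime p a := by
  have hmax : p.IsMaximal := Ideal.IsPrime.isMaximal (Ideal.isPrime_of_prime hp) hp.ne_zero
  rw [Ideal.isCoprime_iff_sup_eq]
  by_contra hne
  exact h (Ideal.dvd_iff_le.2 (le_sup_right.trans (hmax.eq_of_le hne le_sup_left).ge))

theorem isCoprime_iff_forall_prime {a b : Ideal (𝓞 K)} :
    IsCoprime a b ↔ ∀ p : HeightOneSpectrum (𝓞 K), p.asIdeal ∣ a → ¬ p.asIdeal ∣ b := by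
  refine ⟨fun h p ha hb => p.prime.not_isUnit (h.isUnit_of_dvd' ha hb), fun h => ?_⟩
  rw [Ideal.isCoprime_iff_sup_eq]
  by_contra hne
  obtain ⟨m, hm, hle⟩ := Ideal.exists_le_maximal _ hne
  have h1 : m ∣ a := Ideal.dvd_iff_le.2 (le_sup_left.trans hle)
  have h2 : m ∣ b := Ideal.dvd_iff_le.2 (le_sup_right.trans hle)
  have hm0 : m ≠ ⊥ := by
    exact Ring.ne_bot_of_isMaximal_of_not_isField hm (RingOfIntegers.not_isField K)
  exact h ⟨m, hm.isPrime, hm0⟩ h1 h2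

theorem exists_prime_dvd_of_ne_one {a : Ideal (𝓞 K)} (h : a ≠ 1) :
    ∃ p : HeightOneSpectrum (𝓞 K), p.asIdeal ∣ a := by
  by_contra! hp
  have := isCoprime_iff_forall_prime.2 (fun p hpa _ => hp p hpa : ∀ p : HeightOneSpectrum (𝓞 K),
    p.asIdeal ∣ a → ¬ p.asIdeal ∣ a)
  exact h (by simpa [isCoprime_self, Ideal.isUnit_iff] using this)

/-- Inserting or removing one fixed prime factor `p` is a sign-reversing involution on the
squarefree divisors; the other divisors contribute zero. -/
theorem sum_idealMoebius {a : Ideal (𝓞 K)} (ha : a ≠ ⊥) (h1 : a ≠ 1) :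
    ∑ h ∈ idealDivisors a, idealMoebius h = 0 := by
  classical
  obtain ⟨v, hv⟩ := exists_prime_dvd_of_ne_one h1
  set p := v.asIdeal
  have hp : Prime p := v.prime
  have hsub : ∑ h ∈ (idealDivisors a).filter Squarefree, idealMoebius h =
      ∑ h ∈ idealDivisors a, idealMoebius h := by
    rw [Finset.sum_filter]
    exact Finset.sum_congr rfl fun h _ => by
      split_ifs with hs
      · rfl
      · rw [idealMoebius_of_not_squarefree hs]
  rw [← hsub]
  have key : ∀ h : Ideal (𝓞 K), ¬ p ∣ h → idealDiv (p * h) p = h := fun h _ =>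
    idealDiv_eq_of_mul_eq hp.ne_zero rfl
  have nd : ∀ h : Ideal (𝓞 K), Squarefree h → p ∣ h → ¬ p ∣ idealDiv h p := by
    intro h hs hd hd'
    exact hp.not_isUnit (hs p (by
      conv_rhs => rw [← idealDiv_mul_cancel hd]
      exact mul_dvd_mul_left p hd'))
  refine Finset.sum_involution (fun h _ => if p ∣ h then idealDiv h p else p * h) ?_ ?_ ?_ ?_
  · intro h hh
    rw [Finset.mem_filter, mem_idealDivisors ha] at hh
    split_ifs with hd
    · have : idealMoebius h = - idealMoebius (idealDiv h p) := by
        conv_lhs => rw [← idealDiv_mul_cancel hd]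
        rw [idealMoebius_mul (isCoprime_of_prime_not_dvd hp (nd h hh.2 hd)),
          idealMoebius_prime hp, neg_one_mul]
      rw [this, neg_add_cancel]
    · rw [idealMoebius_mul (isCoprime_of_prime_not_dvd hp hd), idealMoebius_prime hp, neg_one_mul,
        add_neg_cancel]
  · intro h hh hne
    rw [Finset.mem_filter, mem_idealDivisors ha] at hh
    split_ifs with hd
    · intro heq
      exact nd h hh.2 hd (by rwa [heq])
    · intro heq
      exact hd (by rw [← heq]; exact dvd_mul_right _ _)
  · intro h hh
    rw [Finset.mem_filter, mem_idealDivisors ha] at hh ⊢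
    split_ifs with hd
    · exact ⟨(idealDiv_dvd hd).trans hh.1, hh.2.squarefree_of_dvd (idealDiv_dvd hd)⟩
    · have hc := isCoprime_of_prime_not_dvd hp hd
      exact ⟨hc.mul_dvd hv hh.1,
        squarefree_mul_iff.2 ⟨hc.isRelPrime, hp.irreducible.squarefree, hh.2⟩⟩
  · intro h hh
    rw [Finset.mem_filter] at hh
    by_cases hd : p ∣ h
    · rw [if_pos hd, if_neg (nd h hh.2 hd), idealDiv_mul_cancel hd]
    · rw [if_neg hd, if_pos (dvd_mul_right _ _), key h hd]

open scoped Classical in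
/-- Möbius inversion, in the form of an indicator of `a = q`. -/
theorem sum_idealMoebius_idealDiv {a q : Ideal (𝓞 K)} (hq : q ≠ ⊥) :
    ∑ k ∈ idealDivisors q, (if a ∣ k then idealMoebius (idealDiv q k) else 0) =
      if a = q then 1 else 0 := by
  by_cases haq : a ∣ q
  · have hdiv : ∀ h ∈ idealDivisors q, (a ∣ idealDiv q h ↔ h ∣ idealDiv q a) := by
      intro h hh
      rw [mem_idealDivisors hq] at hh
      have h1 := idealDiv_mul_cancel hh
      have h2 := idealDiv_mul_cancel haq
      have ha0 := ne_bot_of_dvd hq haq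
      have hh0 := ne_bot_of_dvd hq hh
      constructor
      · rintro ⟨c, hc⟩
        refine ⟨c, mul_left_cancel₀ ha0 ?_⟩
        rw [h2, ← h1, hc]; ring
      · rintro ⟨c, hc⟩
        refine ⟨c, mul_left_cancel₀ hh0 ?_⟩
        rw [h1, ← h2, hc]; ring
    rw [← sum_idealDivisors_idealDiv hq]
    have hsum : ∑ h ∈ idealDivisors q,
        (if a ∣ idealDiv q h then idealMoebius (idealDiv q (idealDiv q h)) else 0) =
        ∑ h ∈ idealDivisors (idealDiv q a), idealMoebius h := by
      have hqa := ne_bot_of_dvd hq (idealDiv_dvd haq)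
      rw [← Finset.sum_filter]
      have : (idealDivisors q).filter (fun h => a ∣ idealDiv q h) =
          idealDivisors (idealDiv q a) := by
        ext h
        rw [Finset.mem_filter, mem_idealDivisors hqa]
        constructor
        · rintro ⟨hh, h2⟩; exact (hdiv h hh).1 h2
        · intro hh
          have hm : h ∈ idealDivisors q := (mem_idealDivisors hq).2 (hh.trans (idealDiv_dvd haq))
          exact ⟨hm, (hdiv h hm).2 hh⟩
      rw [this]
      refine Finset.sum_congr rfl fun h hh => ?_
      rw [mem_idealDivisors hqa] at hh
      rw [idealDiv_idealDiv hq (hh.trans (idealDiv_dvd haq))]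
    rw [hsum]
    by_cases heq : a = q
    · subst heq
      rw [if_pos rfl, idealDiv_eq_of_mul_eq (L := 1) hq (mul_one a)]
      have : idealDivisors (1 : Ideal (𝓞 K)) = {1} := by
        ext h
        rw [mem_idealDivisors (by simp), Finset.mem_singleton, ← isUnit_iff_dvd_one,
          Ideal.isUnit_iff, Ideal.one_eq_top]
      rw [this, Finset.sum_singleton, idealMoebius_one]
    · rw [if_neg heq]
      refine sum_idealMoebius (ne_bot_of_dvd hq (idealDiv_dvd haq)) fun h1 => heq ?_
      have := idealDiv_mul_cancel haq
      rwa [h1, mul_one] at this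
  · rw [if_neg (fun h => haq (h.dvd))]
    refine Finset.sum_eq_zero fun k hk => if_neg fun h => haq (h.trans ?_)
    exact (mem_idealDivisors hq).1 hk

theorem squarefreePart_eq_prod {a : Ideal (𝓞 K)} (ha : a ≠ ⊥) :
    ∃ s : Finset (HeightOneSpectrum (𝓞 K)),
      (∀ v, v ∈ s ↔ v.asIdeal ∣ a ∧ ¬ v.asIdeal ^ 2 ∣ a) ∧
        squarefreePart a = ∏ v ∈ s, v.asIdeal := by
  have hfin : {v : HeightOneSpectrum (𝓞 K) | v.asIdeal ∣ a ∧ ¬ v.asIdeal ^ 2 ∣ a}.Finite :=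
    (Ideal.finite_factors ha).subset fun v hv => hv.1
  refine ⟨hfin.toFinset, fun v => by simp, ?_⟩
  rw [squarefreePart]
  exact finprod_mem_eq_finite_toFinset_prod _ hfin

theorem squarefreePart_dvd {a : Ideal (𝓞 K)} (ha : a ≠ ⊥) : squarefreePart a ∣ a := by
  obtain ⟨s, hs, h⟩ := squarefreePart_eq_prod ha
  rw [h]
  refine Finset.prod_dvd_of_isRelPrime (fun v _ w _ hvw => ?_) fun v hv => ((hs v).1 hv).1
  refine (isCoprime_of_prime_not_dvd v.prime fun hd => hvw ?_).isRelPrime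
  exact HeightOneSpectrum.ext (w.isMaximal.eq_of_le v.isPrime.ne_top (Ideal.dvd_iff_le.1 hd)).symm

/-- A squarefree ideal has no repeated factor, so divisibility can be tested on its set of prime
factors. -/
theorem dvd_squarefreePart {a f : Ideal (𝓞 K)} (ha : a ≠ ⊥) (hf : Squarefree f)
    (h : ∀ v : HeightOneSpectrum (𝓞 K), v.asIdeal ∣ f → v.asIdeal ∣ a ∧ ¬ v.asIdeal ^ 2 ∣ a) :
    f ∣ squarefreePart a := by
  obtain ⟨s, hs, hsa⟩ := squarefreePart_eq_prod ha
  rw [hsa]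
  have hP : ∏ v ∈ s, v.asIdeal ≠ 0 := Finset.prod_ne_zero_iff.2 fun v _ => v.ne_bot
  rw [UniqueFactorizationMonoid.dvd_iff_normalizedFactors_le_normalizedFactors hf.ne_zero hP,
    Multiset.le_iff_subset
      ((UniqueFactorizationMonoid.squarefree_iff_nodup_normalizedFactors hf.ne_zero).1 hf)]
  intro p hp
  rw [UniqueFactorizationMonoid.mem_normalizedFactors_iff' hf.ne_zero] at hp
  rw [UniqueFactorizationMonoid.mem_normalizedFactors_iff' hP]
  refine ⟨hp.1, hp.2.1, ?_⟩
  have hpp : Prime p := hp.1.prime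
  exact Finset.dvd_prod_of_mem (fun v : HeightOneSpectrum (𝓞 K) => v.asIdeal)
    (a := ⟨p, Ideal.isPrime_of_prime hpp, hpp.ne_zero⟩) ((hs _).2 (h _ hp.2.2))

end IdealArithmetic

/-! ### Local orders and approximation -/

section Order

variable {K : Type*} [Field K] [NumberField K]

/-- `x` has order at least `n` at the finite place `v`. -/
def OrdGe (v : HeightOneSpectrum (𝓞 K)) (n : ℤ) (x : K) : Prop :=
  v.valuation K x ≤ WithZero.exp (-n)

variable {v : HeightOneSpectrum (𝓞 K)}

namespace OrdGe

theorem add {n : ℤ} {x y : K} (hx : OrdGe v n x) (hy : OrdGe v n y) : OrdGe v n (x + y) :=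
  ((v.valuation K).map_add _ _).trans (max_le hx hy)

theorem neg {n : ℤ} {x : K} (hx : OrdGe v n x) : OrdGe v n (-x) := by
  rwa [OrdGe, Valuation.map_neg]

theorem sub {n : ℤ} {x y : K} (hx : OrdGe v n x) (hy : OrdGe v n y) : OrdGe v n (x - y) :=
  ((v.valuation K).map_sub _ _).trans (max_le hx hy)

theorem mono {m n : ℤ} {x : K} (hx : OrdGe v n x) (h : m ≤ n) : OrdGe v m x :=
  hx.trans (WithZero.exp_le_exp.2 (neg_le_neg h))

theorem mul {m n : ℤ} {x y : K} (hx : OrdGe v m x) (hy : OrdGe v n y) :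
    OrdGe v (m + n) (x * y) := by
  rw [OrdGe, map_mul, neg_add, WithZero.exp_add]
  exact mul_le_mul' hx hy

theorem algebraMap (a : 𝓞 K) : OrdGe v 0 (algebraMap (𝓞 K) K a) := by
  simpa [OrdGe] using v.valuation_le_one (K := K) a

theorem zero (n : ℤ) : OrdGe v n (0 : K) := by simp [OrdGe]

end OrdGe

theorem ordGe_zero_iff {x : K} : OrdGe v 0 x ↔ v.valuation K x ≤ 1 := by simp [OrdGe]

theorem ordGe_mul_iff {m : ℤ} {a : K} (ha : v.valuation K a = WithZero.exp (-m)) (n : ℤ) (x : K) :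
    OrdGe v (m + n) (a * x) ↔ OrdGe v n x := by
  rw [OrdGe, OrdGe, map_mul, ha, neg_add, WithZero.exp_add]
  exact mul_le_mul_iff_of_pos_left (WithZero.exp_pos)

theorem valuation_eq_exp_count {a : 𝓞 K} (ha : a ≠ 0) :
    v.valuation K (algebraMap (𝓞 K) K a) = WithZero.exp
      (-(FractionalIdeal.count K v ((Ideal.span {a} : Ideal (𝓞 K)) : FracIdeal K))) := by
  classical
  rw [HeightOneSpectrum.valuation_of_algebraMap, HeightOneSpectrum.intValuation_if_neg _ ha,
    FractionalIdeal.count_coe K v (by simpa using ha)]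

theorem mem_coeIdeal_iff_ordGe {J : Ideal (𝓞 K)} (hJ : J ≠ ⊥) {x : K} :
    x ∈ (J : FracIdeal K) ↔ ∀ v : HeightOneSpectrum (𝓞 K),
      OrdGe v (FractionalIdeal.count K v (J : FracIdeal K)) x := by
  classical
  have key : ∀ r : 𝓞 K, r ∈ J ↔ ∀ v : HeightOneSpectrum (𝓞 K),
      OrdGe v (FractionalIdeal.count K v (J : FracIdeal K)) (algebraMap (𝓞 K) K r) := by
    intro r
    conv_lhs => rw [← Ideal.iInf_maxPowDividing_eq hJ, Ideal.mem_iInf]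
    refine forall_congr' fun v => ?_
    rw [FractionalIdeal.count_coe K v hJ, OrdGe, HeightOneSpectrum.valuation_of_algebraMap,
      HeightOneSpectrum.intValuation_le_pow_iff_mem]
    rfl
  rw [FractionalIdeal.mem_coeIdeal]
  constructor
  · rintro ⟨r, hr, rfl⟩
    exact (key r).1 hr
  · intro h
    obtain ⟨r, rfl⟩ := HeightOneSpectrum.mem_integers_of_valuation_le_one (R := 𝓞 K) K x
      fun v => ordGe_zero_iff.1 ((h v).mono (FractionalIdeal.count_coe_nonneg K v J))
    exact ⟨r, (key r).2 h, rfl⟩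

/-- Clearing a denominator reduces this to integral ideals. It turns every later statement about
ideals into linear inequalities between exponents, one place at a time. -/
theorem mem_iff_ordGe {I : FracIdeal K} (hI : I ≠ 0) {x : K} :
    x ∈ I ↔ ∀ v : HeightOneSpectrum (𝓞 K), OrdGe v (FractionalIdeal.count K v I) x := by
  obtain ⟨a, J, ha, hIJ⟩ := FractionalIdeal.exists_eq_spanSingleton_mul I
  have haK : algebraMap (𝓞 K) K a ≠ 0 := by simpa using ha
  have hsa : ((Ideal.span {a} : Ideal (𝓞 K)) : FracIdeal K) ≠ 0 :=
    FractionalIdeal.coeIdeal_ne_zero.2 (by simpa using ha)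
  have hJI : ((Ideal.span {a} : Ideal (𝓞 K)) : FracIdeal K) * I = J := by
    rw [hIJ, FractionalIdeal.coeIdeal_span_singleton, ← mul_assoc,
      FractionalIdeal.spanSingleton_mul_spanSingleton, mul_inv_cancel₀ haK]
    simp
  have hJ : J ≠ ⊥ := by
    rintro rfl
    exact mul_ne_zero hsa hI (by simpa using hJI)
  have h1 : x ∈ I ↔ algebraMap (𝓞 K) K a * x ∈ (J : FracIdeal K) := by
    rw [hIJ, FractionalIdeal.mem_singleton_mul]
    constructor
    · rintro ⟨y, hy, rfl⟩
      rwa [← mul_assoc, mul_inv_cancel₀ haK, one_mul]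
    · intro h
      exact ⟨_, h, by rw [← mul_assoc, inv_mul_cancel₀ haK, one_mul]⟩
  rw [h1, mem_coeIdeal_iff_ordGe hJ]
  refine forall_congr' fun v => ?_
  rw [← hJI, FractionalIdeal.count_mul K v hsa hI,
    ordGe_mul_iff (valuation_eq_exp_count ha)]

theorem finite_not_ordGe {I : FracIdeal K} (x : K) :
    {v : HeightOneSpectrum (𝓞 K) | ¬ OrdGe v (FractionalIdeal.count K v I) x}.Finite := by
  refine ((finite_not_integral x).union
    (Filter.eventually_cofinite.1 (FractionalIdeal.finite_factors I))).subset fun v hv => ?_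
  by_contra h
  simp only [Set.mem_union, Set.mem_ofPred_eq, not_or, not_not] at h
  exact hv (by rw [h.2]; exact ordGe_zero_iff.2 h.1)

/-- Approximation of `x` modulo `I` at the places in `S` and of `0` at the other places. -/
theorem exists_approx (S : Set (HeightOneSpectrum (𝓞 K))) (I : FracIdeal K) (x : K) :
    ∃ y : K, (∀ v ∈ S, OrdGe v (FractionalIdeal.count K v I) (y - x)) ∧
      ∀ v ∉ S, OrdGe v (FractionalIdeal.count K v I) y := by
  classical
  -- A factor divisible by a high enough power of `v` moves `x` into `I` locally at `v`.
  have hn : ∀ v : HeightOneSpectrum (𝓞 K), ∃ n : ℕ,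
      ∀ z : K, OrdGe v n z → OrdGe v (FractionalIdeal.count K v I) (x * z) := by
    intro v
    by_cases hx : x = 0
    · exact ⟨0, fun z _ => by rw [hx, zero_mul]; exact OrdGe.zero _⟩
    obtain ⟨m, hm⟩ : ∃ m : ℤ, OrdGe v m x :=
      ⟨-WithZero.log (v.valuation K x), by
        rw [OrdGe, neg_neg, WithZero.exp_log ((Valuation.ne_zero_iff _).2 hx)]⟩
    refine ⟨(FractionalIdeal.count K v I - m).toNat, fun z hz => (hm.mul hz).mono ?_⟩
    have := Int.self_le_toNat (FractionalIdeal.count K v I - m)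
    omega
  choose n hn using hn
  set B := (finite_not_ordGe (I := I) x).toFinset
  -- At the finitely many places where `x` is not in `I`, the Chinese remainder theorem gives an
  -- integer `e` close to `1` on `S` and close to `0` off `S`; the approximation is `x e`. At all
  -- other places integrality of `e` suffices.
  obtain ⟨e, he⟩ := exists_forall_sub_mem_ideal (s := B)
    (fun v : HeightOneSpectrum (𝓞 K) => v.asIdeal) n (fun v _ => v.prime)
    (fun v _ w _ hvw h => hvw (HeightOneSpectrum.ext h))
    (fun v => if (v : HeightOneSpectrum (𝓞 K)) ∈ S then 1 else 0)
  have hpow : ∀ (v : HeightOneSpectrum (𝓞 K)) (a : 𝓞 K), a ∈ v.asIdeal ^ n v →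
      OrdGe v (n v) (algebraMap (𝓞 K) K a) := fun v a ha => by
    rw [OrdGe, HeightOneSpectrum.valuation_of_algebraMap]
    exact (v.intValuation_le_pow_iff_mem a _).2 ha
  have hgood : ∀ v ∉ B, ∀ a : 𝓞 K,
      OrdGe v (FractionalIdeal.count K v I) (x * algebraMap (𝓞 K) K a) := fun v hv a => by
    have : OrdGe v (FractionalIdeal.count K v I) x := by simpa [B] using hv
    simpa using this.mul (OrdGe.algebraMap a)
  refine ⟨x * algebraMap (𝓞 K) K e, fun v hv => ?_, fun v hv => ?_⟩
  · have : x * algebraMap (𝓞 K) K e - x = x * algebraMap (𝓞 K) K (e - 1) := by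
      rw [map_sub, map_one]; ring
    rw [this]
    by_cases hB : v ∈ B
    · refine hn v _ (hpow v _ ?_)
      have := he v hB
      rwa [if_pos hv] at this
    · exact hgood v hB _
  · by_cases hB : v ∈ B
    · refine hn v _ (hpow v _ ?_)
      have := he v hB
      rwa [if_neg hv, sub_zero] at this
    · exact hgood v hB _

theorem coeIdeal_ne_zero' {I : Ideal (𝓞 K)} (hI : I ≠ ⊥) : (I : FracIdeal K) ≠ 0 :=
  FractionalIdeal.coeIdeal_ne_zero.2 hI

theorem count_pos_iff {I : Ideal (𝓞 K)} (hI : I ≠ ⊥) :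
    0 < FractionalIdeal.count K v (I : FracIdeal K) ↔ v.asIdeal ∣ I := by
  classical
  rw [FractionalIdeal.count_coe K v hI, Nat.cast_pos, Nat.pos_iff_ne_zero]
  exact Associates.count_ne_zero_iff_dvd hI v.irreducible

theorem count_eq_zero_of_not_dvd {I : Ideal (𝓞 K)} (hI : I ≠ ⊥) (h : ¬ v.asIdeal ∣ I) :
    FractionalIdeal.count K v (I : FracIdeal K) = 0 :=
  ((FractionalIdeal.count_coe_nonneg K v I).eq_of_not_lt fun h' => h ((count_pos_iff hI).1 h')).symm

theorem count_le_of_dvd {I J : Ideal (𝓞 K)} (hI : I ≠ ⊥) (h : J ∣ I) :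
    FractionalIdeal.count K v (J : FracIdeal K) ≤ FractionalIdeal.count K v (I : FracIdeal K) :=
  FractionalIdeal.count_mono K v (coeIdeal_ne_zero' hI)
    ((FractionalIdeal.coeIdeal_le_coeIdeal K).2 (Ideal.dvd_iff_le.1 h))

theorem different_ne_zero : different K ≠ 0 :=
  coeIdeal_ne_zero' differentIdeal_ne_bot

theorem count_partAt (I : FracIdeal K) {b : Ideal (𝓞 K)} (hb : b ≠ ⊥) (v : HeightOneSpectrum (𝓞 K)) :
    (v.asIdeal ∣ b → FractionalIdeal.count K v (partAt I b) = FractionalIdeal.count K v I) ∧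
      (¬ v.asIdeal ∣ b → FractionalIdeal.count K v (partAt I b) = 0) := by
  classical
  have h : partAt I b = ∏ᶠ w : HeightOneSpectrum (𝓞 K), (w.asIdeal : FracIdeal K) ^
      (if w.asIdeal ∣ b then FractionalIdeal.count K w I else 0) := by
    refine finprod_congr fun w => ?_
    by_cases hw : w.asIdeal ∣ b <;> simp [hw]
  rw [h, FractionalIdeal.count_finprod]
  · constructor <;> intro hv <;> simp [hv]
  · rw [Filter.eventually_cofinite]
    refine (Ideal.finite_factors hb).subset fun w hw => ?_
    by_contra hw'
    exact hw (if_neg hw')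

theorem partAt_ne_zero (I : FracIdeal K) (b : Ideal (𝓞 K)) : partAt I b ≠ 0 := by
  refine finprod_induction (p := fun J : FracIdeal K => J ≠ 0) one_ne_zero (fun _ _ => mul_ne_zero)
    fun w => ?_
  refine finprod_induction (p := fun J : FracIdeal K => J ≠ 0) one_ne_zero (fun _ _ => mul_ne_zero)
    fun _ => zpow_ne_zero _ (coeIdeal_ne_zero' w.ne_bot)

end Order

/-! ### The additive characters and the different -/

section Characters

variable {K : Type*} [Field K] [NumberField K]

/-- The character `x ↦ e(Tr x)` of `K`. -/
def traceChar (x : K) : ℂ := Real.fourierChar ((Algebra.trace ℚ K x : ℚ) : ℝ)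

theorem traceChar_add (x y : K) : traceChar (x + y) = traceChar x * traceChar y := by
  simp [traceChar, AddChar.map_add_eq_mul]

theorem psiInf_eq_traceChar (x : K) : psiInf (mixedEmbedding K x) = traceChar (-x) := by
  rw [psiInf_mixedEmbedding, traceChar, map_neg (Algebra.trace ℚ K), Rat.cast_neg]

theorem mem_different_inv_iff {x : K} : x ∈ (different K)⁻¹ ↔
    ∀ a : 𝓞 K, ∃ m : ℤ, Algebra.trace ℚ K (algebraMap (𝓞 K) K a * x) = m := by
  rw [different, coeIdeal_differentIdeal ℤ ℚ, inv_inv, FractionalIdeal.mem_dual (one_ne_zero (α := FracIdeal K))]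
  constructor
  · intro h a
    obtain ⟨m, hm⟩ := h (algebraMap (𝓞 K) K a) (FractionalIdeal.coe_mem_one _ a)
    rw [Algebra.traceForm_apply, mul_comm] at hm
    exact ⟨m, by rw [← hm]; simp⟩
  · intro h y hy
    obtain ⟨a, rfl⟩ := (FractionalIdeal.mem_one_iff _).1 hy
    obtain ⟨m, hm⟩ := h a
    exact ⟨m, by rw [Algebra.traceForm_apply, mul_comm, hm]; simp⟩

theorem traceChar_eq_one_iff {x : K} :
    traceChar x = 1 ↔ ∃ m : ℤ, Algebra.trace ℚ K x = m := by
  rw [traceChar, Real.fourierChar_apply, Complex.exp_eq_one_iff]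
  have hpi : (2 * Real.pi * Complex.I : ℂ) ≠ 0 := Complex.two_pi_I_ne_zero
  refine exists_congr fun m => ?_
  rw [← Rat.cast_inj (α := ℂ), Rat.cast_intCast]
  push_cast
  constructor
  · intro h
    exact mul_right_cancel₀ hpi (by linear_combination h)
  · intro h
    linear_combination (2 * Real.pi * Complex.I : ℂ) * h

theorem traceChar_eq_one_of_mem {x : K} (hx : x ∈ (different K)⁻¹) : traceChar x = 1 := by
  rw [traceChar_eq_one_iff]
  simpa using mem_different_inv_iff.1 hx 1

/-- The inverse different is the trace dual of `𝓞 K`. This nondegeneracy is the source of all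
cancellation below. -/
theorem exists_traceChar_ne_one {x : K} (hx : x ∉ (different K)⁻¹) :
    ∃ a : 𝓞 K, traceChar (algebraMap (𝓞 K) K a * x) ≠ 1 := by
  by_contra! h
  exact hx (mem_different_inv_iff.2 fun a => traceChar_eq_one_iff.1 (h a))

/-- The exponent at `v` of the different. -/
def ordDiff (K : Type*) [Field K] [NumberField K] (v : HeightOneSpectrum (𝓞 K)) : ℤ :=
  FractionalIdeal.count K v (different K)

theorem ordDiff_nonneg (v : HeightOneSpectrum (𝓞 K)) : 0 ≤ ordDiff K v :=
  FractionalIdeal.count_coe_nonneg K v _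

theorem mem_different_inv_iff_ordGe {x : K} :
    x ∈ (different K)⁻¹ ↔ ∀ v : HeightOneSpectrum (𝓞 K), OrdGe v (-ordDiff K v) x := by
  rw [mem_iff_ordGe (inv_ne_zero different_ne_zero)]
  simp only [FractionalIdeal.count_inv, ordDiff]

/-- The definition of `psiLoc` only makes triviality on the local integers evident. On the larger
local inverse different, a polar part of `x` lies in `𝔇⁻¹` at every place, so its trace is an
integer. -/
theorem psiLoc_eq_one {v : HeightOneSpectrum (𝓞 K)} {x : K} (hx : OrdGe v (-ordDiff K v) x) :
    psiLoc v (algebraMap K (v.adicCompletion K) x) = 1 := by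
  obtain ⟨k, hk⟩ := exists_isPolarPart v (algebraMap K (v.adicCompletion K) x)
  rw [psiLoc_eq hk]
  refine Circle.ext ?_
  rw [Circle.coe_one]
  refine traceChar_eq_one_of_mem (mem_different_inv_iff_ordGe.2 fun w => ?_)
  by_cases hw : w = v
  · subst hw
    have h1 : OrdGe w 0 (x - k) := by
      rw [ordGe_zero_iff, ← valued_algebraMap, map_sub]
      exact hk.1
    have := hx.sub (h1.mono (neg_nonpos.2 (ordDiff_nonneg w)))
    rwa [sub_sub_cancel] at this
  · exact (ordGe_zero_iff.2 (hk.2 w hw)).mono (neg_nonpos.2 (ordDiff_nonneg w))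

theorem psiIdeal_add {b : Ideal (𝓞 K)} (hb : b ≠ ⊥) (x y : K) :
    psiIdeal b (x + y) = psiIdeal b x * psiIdeal b y := by
  have hfin : {v : HeightOneSpectrum (𝓞 K) | v.asIdeal ∣ b}.Finite := Ideal.finite_factors hb
  refine Eq.trans ?_ (finprod_mem_mul_distrib (f := fun v : HeightOneSpectrum (𝓞 K) =>
    (psiLoc v (algebraMap K (v.adicCompletion K) x) : ℂ)) (g := fun v =>
    (psiLoc v (algebraMap K (v.adicCompletion K) y) : ℂ)) hfin)
  refine finprod_congr fun v => finprod_congr fun _ => ?_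
  rw [map_add, AddChar.map_add_eq_mul, Circle.coe_mul]

theorem psiIdeal_eq_of_dvd {b b' : Ideal (𝓞 K)} (h : b' ∣ b) {x : K}
    (hx : ∀ v : HeightOneSpectrum (𝓞 K), v.asIdeal ∣ b → ¬ v.asIdeal ∣ b' →
      OrdGe v (-ordDiff K v) x) : psiIdeal b x = psiIdeal b' x := by
  refine finprod_congr fun v => ?_
  by_cases h1 : v.asIdeal ∣ b'
  · simp [h1, h1.trans h]
  · by_cases h2 : v.asIdeal ∣ b
    · simp [h1, h2, psiLoc_eq_one (hx v h2 h1)]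
    · simp [h1, h2]

theorem psiIdeal_eq_one {b : Ideal (𝓞 K)} {x : K}
    (hx : ∀ v : HeightOneSpectrum (𝓞 K), v.asIdeal ∣ b → OrdGe v (-ordDiff K v) x) :
    psiIdeal b x = 1 := by
  rw [psiIdeal_eq_of_dvd (one_dvd b) fun v hv _ => hx v hv]
  refine finprod_eq_one_of_forall_eq_one fun v => ?_
  have h : ¬ v.asIdeal ∣ 1 := fun h => v.prime.not_isUnit (isUnit_of_dvd_one h)
  have : IsEmpty (v.asIdeal ∣ 1) := ⟨h⟩
  exact finprod_of_isEmpty _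

/-- This is the product formula for `ψ`: the factors away from `b` are trivial at `x`, so those at
`b` already make up the global value `e(Tr x)`. -/
theorem psiIdeal_eq_traceChar {b : Ideal (𝓞 K)} {x : K}
    (hx : ∀ v : HeightOneSpectrum (𝓞 K), ¬ v.asIdeal ∣ b → OrdGe v (-ordDiff K v) x) :
    psiIdeal b x = traceChar x := by
  rw [traceChar, ← finprod_psiLoc]
  refine Eq.trans ?_ (Circle.coeHom.map_finprod_of_injective (fun _ _ h => Circle.ext h) _).symm
  refine finprod_congr fun v => ?_
  by_cases h : v.asIdeal ∣ b
  · classical rw [finprod_eq_if, if_pos h]; rfl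
  · simp [h, psiLoc_eq_one (hx v h)]

theorem psiIdeal_neg_mul {b : Ideal (𝓞 K)} (hb : b ≠ ⊥) (x : K) :
    psiIdeal b (-x) * psiIdeal b x = 1 := by
  rw [← psiIdeal_add hb, neg_add_cancel]
  exact psiIdeal_eq_one fun v _ => OrdGe.zero _

end Characters

/-! ### The torsion module `K / 𝔇⁻¹` -/

section TorsionModule

variable (K : Type*) [Field K] [NumberField K]

/-- The quotient `K / 𝔇⁻¹`. -/
abbrev DualQuotient := K ⧸ (((different K)⁻¹ : FracIdeal K) : Submodule (𝓞 K) K)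

variable {K}

theorem dualQuotient_mk_eq_zero {x : K} :
    (Submodule.Quotient.mk x : DualQuotient K) = 0 ↔ x ∈ (different K)⁻¹ :=
  Submodule.Quotient.mk_eq_zero _

/-- The character of `K / 𝔇⁻¹` induced by `x ↦ e(Tr x)`. -/
def quotChar (X : DualQuotient K) : ℂ := traceChar X.out

theorem quotChar_mk (x : K) : quotChar (Submodule.Quotient.mk x : DualQuotient K) = traceChar x := by
  have h : (Quotient.out (Submodule.Quotient.mk x : DualQuotient K)) - x ∈ (different K)⁻¹ := by
    rw [← dualQuotient_mk_eq_zero, Submodule.Quotient.mk_sub, sub_eq_zero]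
    exact Quotient.out_eq _
  rw [quotChar, ← sub_add_cancel (Quotient.out _) x, traceChar_add, traceChar_eq_one_of_mem h,
    one_mul]

theorem quotChar_add (X Y : DualQuotient K) : quotChar (X + Y) = quotChar X * quotChar Y := by
  obtain ⟨x, rfl⟩ := Submodule.Quotient.mk_surjective _ X
  obtain ⟨y, rfl⟩ := Submodule.Quotient.mk_surjective _ Y
  rw [← Submodule.Quotient.mk_add, quotChar_mk, quotChar_mk, quotChar_mk, traceChar_add]

theorem quotChar_zero : quotChar (0 : DualQuotient K) = 1 := by
  rw [← Submodule.Quotient.mk_zero, quotChar_mk]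
  exact traceChar_eq_one_of_mem (Submodule.zero_mem _)

theorem exists_quotChar_smul_ne_one {X : DualQuotient K} (hX : X ≠ 0) :
    ∃ a : 𝓞 K, quotChar (a • X) ≠ 1 := by
  obtain ⟨x, rfl⟩ := Submodule.Quotient.mk_surjective _ X
  obtain ⟨a, ha⟩ := exists_traceChar_ne_one (x := x) fun h => hX (dualQuotient_mk_eq_zero.2 h)
  refine ⟨a, ?_⟩
  rwa [← Submodule.Quotient.mk_smul, quotChar_mk, Algebra.smul_def]

/-- The annihilator of an element of `K / 𝔇⁻¹`. -/
def annOf (X : DualQuotient K) : Ideal (𝓞 K) := LinearMap.ker (LinearMap.toSpanSingleton (𝓞 K) _ X)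

theorem mem_annOf {X : DualQuotient K} {a : 𝓞 K} : a ∈ annOf X ↔ a • X = 0 := by
  simp [annOf]

/-- The `k`-torsion of `K / 𝔇⁻¹`. -/
def torsionBy (k : Ideal (𝓞 K)) : Submodule (𝓞 K) (DualQuotient K) where
  carrier := {X | annOf X ∣ k}
  zero_mem' := by
    rw [Set.mem_ofPred_eq, Ideal.dvd_iff_le]; intro a _; simp [mem_annOf]
  add_mem' {X Y} hX hY := by
    rw [Set.mem_ofPred_eq, Ideal.dvd_iff_le] at *
    intro a ha
    rw [mem_annOf, smul_add, mem_annOf.1 (hX ha), mem_annOf.1 (hY ha), add_zero]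
  smul_mem' c X hX := by
    rw [Set.mem_ofPred_eq, Ideal.dvd_iff_le] at *
    intro a ha
    rw [mem_annOf, smul_comm, mem_annOf.1 (hX ha), smul_zero]

theorem mem_torsionBy {k : Ideal (𝓞 K)} {X : DualQuotient K} : X ∈ torsionBy k ↔ annOf X ∣ k :=
  Iff.rfl

theorem mem_torsionBy' {k : Ideal (𝓞 K)} {X : DualQuotient K} :
    X ∈ torsionBy k ↔ ∀ a ∈ k, a • X = 0 := by
  rw [mem_torsionBy, Ideal.dvd_iff_le]
  exact forall₂_congr fun a _ => mem_annOf

theorem mk_mem_torsionBy {k : Ideal (𝓞 K)} (hk : k ≠ ⊥) {x : K} :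
    (Submodule.Quotient.mk x : DualQuotient K) ∈ torsionBy k ↔
      x ∈ ((k : FracIdeal K) * different K)⁻¹ := by
  have hk' := coeIdeal_ne_zero' (K := K) hk
  rw [mem_torsionBy', mul_inv, ← FractionalIdeal.spanSingleton_le_iff_mem,
    ← mul_le_mul_iff_right₀ (bot_lt_iff_ne_bot.2 hk'), ← mul_assoc,
    mul_inv_cancel₀ hk', one_mul, FractionalIdeal.mul_le]
  simp only [← Submodule.Quotient.mk_smul, dualQuotient_mk_eq_zero]
  constructor
  · rintro h i hi j hj
    obtain ⟨a, ha, rfl⟩ := (FractionalIdeal.mem_coeIdeal _).1 hi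
    obtain ⟨c, rfl⟩ := (FractionalIdeal.mem_spanSingleton _).1 hj
    rw [mul_smul_comm, ← Algebra.smul_def]
    exact Submodule.smul_mem _ _ (h a ha)
  · intro h a ha
    rw [Algebra.smul_def]
    exact h _ (FractionalIdeal.mem_coeIdeal_of_mem _ ha) _ (FractionalIdeal.mem_spanSingleton_self _ _)

/-- The torsion submodule of a nonzero ideal `k` is cyclic with annihilator `k`. -/
theorem exists_torsionBy_eq_span {k : Ideal (𝓞 K)} (hk : k ≠ ⊥) :
    ∃ X : DualQuotient K, torsionBy k = Submodule.span (𝓞 K) {X} ∧ annOf X = k := by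
  have hk' := coeIdeal_ne_zero' (K := K) hk
  have hD := different_ne_zero (K := K)
  have hle : (different K)⁻¹ ≤ ((k : FracIdeal K) * different K)⁻¹ := by
    intro x hx
    rw [← mk_mem_torsionBy hk, dualQuotient_mk_eq_zero.2 hx]
    exact Submodule.zero_mem _
  -- In a Dedekind domain the larger fractional ideal is the smaller one plus a principal one:
  -- `(k𝔇)⁻¹ = 𝔇⁻¹ + (x)`. The class of `x` is the generator.
  obtain ⟨x, hx⟩ := IsDedekindDomain.exists_add_spanSingleton_mul_eq hle (inv_ne_zero hD) one_ne_zero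
  rw [mul_one] at hx
  have hspan : torsionBy k = Submodule.span (𝓞 K) {(Submodule.Quotient.mk x : DualQuotient K)} := by
    ext Y
    obtain ⟨y, rfl⟩ := Submodule.Quotient.mk_surjective _ Y
    rw [mk_mem_torsionBy hk, ← hx, FractionalIdeal.mem_add, Submodule.mem_span_singleton]
    constructor
    · rintro ⟨i, hi, j, hj, rfl⟩
      obtain ⟨c, rfl⟩ := (FractionalIdeal.mem_spanSingleton _).1 hj
      exact ⟨c, by rw [Submodule.Quotient.mk_add, dualQuotient_mk_eq_zero.2 hi, zero_add]; rfl⟩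
    · rintro ⟨c, hc⟩
      rw [← Submodule.Quotient.mk_smul, eq_comm, Submodule.Quotient.eq] at hc
      exact ⟨_, hc, _, (FractionalIdeal.mem_spanSingleton _).2 ⟨c, rfl⟩, by ring⟩
  refine ⟨Submodule.Quotient.mk x, hspan, le_antisymm (fun a ha => ?_) ?_⟩
  · by_cases ha0 : a = 0
    · rw [ha0]; exact Ideal.zero_mem k
    have hs : Ideal.span {a} ≠ ⊥ := by simpa using ha0
    -- If `a` kills the generator, it kills the whole `k`-torsion; comparing `(k𝔇)⁻¹` with `(a𝔇)⁻¹`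
    -- and cancelling gives `a ∈ k`.
    have h1 : ((k : FracIdeal K) * different K)⁻¹ ≤
        (((Ideal.span {a} : Ideal (𝓞 K)) : FracIdeal K) * different K)⁻¹ := by
      intro y hy
      rw [← mk_mem_torsionBy hk, hspan, Submodule.mem_span_singleton] at hy
      obtain ⟨c, hc⟩ := hy
      rw [← mk_mem_torsionBy hs, ← hc, mem_torsionBy']
      intro u hu
      obtain ⟨t, rfl⟩ := Ideal.mem_span_singleton'.1 hu
      rw [smul_smul, show t * a * c = (t * c) * a by ring, mul_smul, mem_annOf.1 ha, smul_zero]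
    rw [mul_inv, mul_inv] at h1
    have h2 := (mul_le_mul_iff_left₀ (bot_lt_iff_ne_bot.2 (inv_ne_zero hD))).1 h1
    rw [inv_le_inv₀ (bot_lt_iff_ne_bot.2 hk') (bot_lt_iff_ne_bot.2 (coeIdeal_ne_zero' hs)),
      FractionalIdeal.coeIdeal_le_coeIdeal] at h2
    exact h2 (Ideal.mem_span_singleton_self a)
  · have : (Submodule.Quotient.mk x : DualQuotient K) ∈ torsionBy k := by
      rw [hspan]; exact Submodule.mem_span_singleton_self _
    exact Ideal.dvd_iff_le.1 (mem_torsionBy.1 this)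

theorem card_torsionBy {k : Ideal (𝓞 K)} (hk : k ≠ ⊥) :
    Nat.card (torsionBy k : Submodule (𝓞 K) (DualQuotient K)) = Ideal.absNorm k := by
  obtain ⟨X, hX, hann⟩ := exists_torsionBy_eq_span hk
  rw [hX, ← LinearMap.range_toSpanSingleton, Ideal.absNorm_apply, Submodule.cardQuot_apply, ← hann]
  exact (Nat.card_congr (LinearMap.quotKerEquivRange _).toEquiv).symm

theorem finite_torsionBy {k : Ideal (𝓞 K)} (hk : k ≠ ⊥) :
    (torsionBy k : Set (DualQuotient K)).Finite := by
  refine Set.finite_coe_iff.1 (Nat.finite_of_card_ne_zero (α := torsionBy k) ?_)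
  rw [card_torsionBy hk]
  exact fun h => hk (Ideal.absNorm_eq_zero_iff.1 h)

end TorsionModule

/-! ### Orthogonality, Ramanujan sums and shifted torsion sums -/

section TorsionSums

variable {K : Type*} [Field K] [NumberField K]

/-- The `k`-torsion of `K / 𝔇⁻¹` as a finite set (for `k ≠ ⊥`). -/
def torsionFinset (k : Ideal (𝓞 K)) : Finset (DualQuotient K) :=
  open scoped Classical in if hk : k ≠ ⊥ then (finite_torsionBy hk).toFinset else ∅

theorem mem_torsionFinset {k : Ideal (𝓞 K)} (hk : k ≠ ⊥) {X : DualQuotient K} :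
    X ∈ torsionFinset k ↔ X ∈ torsionBy k := by
  simp [torsionFinset, hk]

theorem card_torsionFinset {k : Ideal (𝓞 K)} (hk : k ≠ ⊥) :
    (torsionFinset k).card = Ideal.absNorm k := by
  rw [← card_torsionBy hk, torsionFinset, dif_pos hk]
  exact (Nat.card_eq_card_finite_toFinset _).symm

theorem torsionBy_mono {k l : Ideal (𝓞 K)} (h : k ∣ l) :
    (torsionBy k : Submodule (𝓞 K) (DualQuotient K)) ≤ torsionBy l :=
  fun _ hX => dvd_trans (mem_torsionBy.1 hX) h

/-- Translation by `t` permutes `S` and multiplies the sum by `c ≠ 1`. -/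
theorem sum_eq_zero_of_translate {S : Finset (DualQuotient K)} {f : DualQuotient K → ℂ}
    (t : DualQuotient K) (c : ℂ) (hc : c ≠ 1) (hS : ∀ X, X + t ∈ S ↔ X ∈ S)
    (hf : ∀ X, f (X + t) = c * f X) : ∑ X ∈ S, f X = 0 := by
  have h : ∑ X ∈ S, f X = c * ∑ X ∈ S, f X := by
    rw [Finset.mul_sum]
    refine Finset.sum_nbij' (· - t) (· + t) (fun X hX => ?_) (fun X hX => (hS X).2 hX) ?_ ?_ ?_
    · rw [← hS, sub_add_cancel]; exact hX
    · intro X _; exact sub_add_cancel X t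
    · intro X _; exact add_sub_cancel_right X t
    · intro X _; rw [← hf, sub_add_cancel]
  have h' : (1 - c) * ∑ X ∈ S, f X = 0 := by linear_combination h
  exact (mul_eq_zero.1 h').resolve_left (sub_ne_zero.2 hc.symm)

open scoped Classical in
/-- Orthogonality for the `k`-torsion of `K / 𝔇⁻¹`. -/
theorem sum_quotChar_smul {k : Ideal (𝓞 K)} (hk : k ≠ ⊥) (u : 𝓞 K) :
    ∑ Y ∈ torsionFinset k, quotChar (u • Y) = if u ∈ k then (Ideal.absNorm k : ℂ) else 0 := by
  split_ifs with hu
  · rw [← card_torsionFinset hk, Finset.sum_congr rfl (g := fun _ => (1 : ℂ)) fun Y hY => ?_]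
    · simp
    · rw [mem_torsionBy'.1 ((mem_torsionFinset hk).1 hY) u hu, quotChar_zero]
  · obtain ⟨X, hX, hann⟩ := exists_torsionBy_eq_span hk
    -- For `u ∉ k` the generator `X` has `u X ≠ 0`, so some multiple `a X` is a translation on which
    -- the character is nontrivial.
    have hne : u • X ≠ 0 := fun h => hu (hann ▸ mem_annOf.2 h)
    obtain ⟨a, ha⟩ := exists_quotChar_smul_ne_one hne
    have haX : a • X ∈ torsionBy k :=
      Submodule.smul_mem _ _ (hX ▸ Submodule.mem_span_singleton_self X)
    refine sum_eq_zero_of_translate (a • X) (quotChar (a • u • X)) ha (fun Y => ?_) fun Y => ?_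
    · rw [mem_torsionFinset hk, mem_torsionFinset hk]
      exact Submodule.add_mem_iff_left _ haX
    · rw [smul_add, quotChar_add, smul_comm u a, mul_comm]

/-- The elements of `K / 𝔇⁻¹` with annihilator `q`. -/
def primitiveFinset (q : Ideal (𝓞 K)) : Finset (DualQuotient K) :=
  open scoped Classical in (torsionFinset q).filter fun X => annOf X = q

theorem mem_primitiveFinset {q : Ideal (𝓞 K)} (hq : q ≠ ⊥) {X : DualQuotient K} :
    X ∈ primitiveFinset q ↔ annOf X = q := by
  rw [primitiveFinset, Finset.mem_filter, mem_torsionFinset hq, mem_torsionBy]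
  exact ⟨fun h => h.2, fun h => ⟨h.dvd, h⟩⟩

/-- Möbius inversion for sums over the elements with annihilator `q`. -/
theorem sum_primitiveFinset {q : Ideal (𝓞 K)} (hq : q ≠ ⊥) (f : DualQuotient K → ℂ) :
    ∑ X ∈ primitiveFinset q, f X =
      ∑ k ∈ idealDivisors q, (idealMoebius (idealDiv q k) : ℂ) * ∑ X ∈ torsionFinset k, f X := by
  classical
  have h1 : ∀ k ∈ idealDivisors q, ∑ X ∈ torsionFinset k, f X =
      ∑ X ∈ torsionFinset q, if annOf X ∣ k then f X else 0 := by
    intro k hk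
    rw [mem_idealDivisors hq] at hk
    rw [← Finset.sum_filter]
    refine Finset.sum_congr (Finset.ext fun X => ?_) fun _ _ => rfl
    rw [Finset.mem_filter, mem_torsionFinset (ne_bot_of_dvd hq hk), mem_torsionFinset hq,
      mem_torsionBy, mem_torsionBy]
    exact ⟨fun h => ⟨h.trans hk, h⟩, fun h => h.2⟩
  symm
  -- After the sums are exchanged, the coefficient of `f X` is the Möbius indicator of `annOf X =
  -- q`.
  rw [Finset.sum_congr rfl fun k hk => by rw [h1 k hk, Finset.mul_sum], Finset.sum_comm,
    primitiveFinset, Finset.sum_filter]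
  refine Finset.sum_congr rfl fun X _ => ?_
  have h2 := congrArg (fun n : ℤ => (n : ℂ) * f X) (sum_idealMoebius_idealDiv (a := annOf X) hq)
  rw [Int.cast_sum, Finset.sum_mul] at h2
  rw [show (if annOf X = q then f X else 0) = ((if annOf X = q then (1 : ℤ) else 0 : ℤ) : ℂ) * f X by
    split_ifs <;> simp]
  rw [← h2]
  refine Finset.sum_congr rfl fun k _ => ?_
  split_ifs <;> simp

open scoped Classical in
/-- The Ramanujan sum. -/
theorem sum_primitiveFinset_quotChar_smul {q : Ideal (𝓞 K)} (hq : q ≠ ⊥) (u : 𝓞 K) :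
    ∑ Y ∈ primitiveFinset q, quotChar (u • Y) = ∑ k ∈ idealDivisors q,
      if u ∈ k then (idealMoebius (idealDiv q k) : ℂ) * (Ideal.absNorm k : ℂ) else 0 := by
  rw [sum_primitiveFinset hq]
  refine Finset.sum_congr rfl fun k hk => ?_
  rw [sum_quotChar_smul (ne_bot_of_dvd hq ((mem_idealDivisors hq).1 hk)), mul_ite, mul_zero]

open scoped Classical in
-- For coprime `k`, `l` the range is empty: `Δ = (X + Δ) - X` would be killed by `k l`. Otherwise
-- the range is stable under the `(k + l)`-torsion, on which the character is not trivial.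
theorem sum_quotChar_shift_eq_zero {k l : Ideal (𝓞 K)} (hk : k ≠ ⊥)
    (Δ : DualQuotient K) (h : ¬ (IsCoprime k l ∧ Δ ∈ torsionBy (k * l))) :
    ∑ X ∈ torsionFinset k with X + Δ ∈ torsionBy l, quotChar X = 0 := by
  by_cases hc : IsCoprime k l
  · refine Finset.sum_eq_zero fun X hX => absurd ⟨hc, ?_⟩ h
    rw [Finset.mem_filter, mem_torsionFinset hk] at hX
    have := Submodule.sub_mem _ (torsionBy_mono (dvd_mul_left l k) hX.2)
      (torsionBy_mono (dvd_mul_right k l) hX.1)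
    rwa [add_sub_cancel_left] at this
  · have hkl : k ⊔ l ≠ ⊥ := fun h0 => hk (eq_bot_iff.2 (h0 ▸ le_sup_left))
    obtain ⟨X, hX, hann⟩ := exists_torsionBy_eq_span hkl
    have hX0 : X ≠ 0 := by
      rintro rfl
      refine hc (Ideal.isCoprime_iff_sup_eq.2 (hann ▸ ?_))
      rw [Ideal.eq_top_iff_one, mem_annOf, smul_zero]
    obtain ⟨a, ha⟩ := exists_quotChar_smul_ne_one hX0
    have haX : a • X ∈ torsionBy (k ⊔ l) :=
      Submodule.smul_mem _ _ (hX ▸ Submodule.mem_span_singleton_self X)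
    have hk' := torsionBy_mono (Ideal.dvd_iff_le.2 le_sup_left : k ⊔ l ∣ k) haX
    have hl' := torsionBy_mono (Ideal.dvd_iff_le.2 le_sup_right : k ⊔ l ∣ l) haX
    refine sum_eq_zero_of_translate (a • X) _ ha (fun Y => ?_) fun Y => ?_
    · rw [Finset.mem_filter, Finset.mem_filter, mem_torsionFinset hk, mem_torsionFinset hk,
        add_right_comm, Submodule.add_mem_iff_left _ hk', Submodule.add_mem_iff_left _ hl']
    · rw [quotChar_add, mul_comm]

open scoped Classical in
-- With `e + e' = 1`, `e ∈ k`, `e' ∈ l`, the element `-e'Δ` satisfies both torsion conditions. Two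
-- solutions differ by an element killed by both `k` and `l`, hence by zero.
theorem exists_sum_quotChar_shift_eq {k l : Ideal (𝓞 K)} (hk : k ≠ ⊥)
    {Δ : DualQuotient K} (hc : IsCoprime k l) (hΔ : Δ ∈ torsionBy (k * l)) :
    ∃ X : DualQuotient K, X ∈ torsionBy k ∧ X + Δ ∈ torsionBy l ∧
      ∑ X ∈ torsionFinset k with X + Δ ∈ torsionBy l, quotChar X = quotChar X := by
  obtain ⟨e, he, e', he', hsum⟩ := Ideal.isCoprime_iff_exists.1 hc
  have hX : -(e' • Δ) ∈ torsionBy k := by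
    refine Submodule.neg_mem _ (mem_torsionBy'.2 fun a ha => ?_)
    rw [smul_smul]
    exact mem_torsionBy'.1 hΔ _ (Ideal.mul_mem_mul ha he')
  have hXl : -(e' • Δ) + Δ ∈ torsionBy l := by
    have : -(e' • Δ) + Δ = e • Δ := by
      rw [neg_add_eq_sub, sub_eq_iff_eq_add, ← add_smul, hsum, one_smul]
    rw [this]
    refine mem_torsionBy'.2 fun a ha => ?_
    rw [smul_smul, mul_comm]
    exact mem_torsionBy'.1 hΔ _ (Ideal.mul_mem_mul he ha)
  refine ⟨_, hX, hXl, ?_⟩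
  have : (torsionFinset k).filter (fun X => X + Δ ∈ torsionBy l) = {-(e' • Δ)} := by
    ext Y
    rw [Finset.mem_filter, mem_torsionFinset hk, Finset.mem_singleton]
    constructor
    · rintro ⟨h1, h2⟩
      have hd1 := Submodule.sub_mem _ h1 hX
      have hd2 := Submodule.sub_mem _ h2 hXl
      rw [add_sub_add_right_eq_sub] at hd2
      rw [← sub_eq_zero, ← one_smul (𝓞 K) (Y - _), ← hsum, add_smul,
        mem_torsionBy'.1 hd1 e he, mem_torsionBy'.1 hd2 e' he', add_zero]
    · rintro rfl
      exact ⟨hX, hXl⟩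
  rw [this, Finset.sum_singleton]

end TorsionSums

theorem algebraMap_mem_coeIdeal_iff {K : Type*} [Field K] [NumberField K] {I : Ideal (𝓞 K)}
    {a : 𝓞 K} : algebraMap (𝓞 K) K a ∈ (I : FracIdeal K) ↔ a ∈ I := by
  rw [FractionalIdeal.mem_coeIdeal]
  exact ⟨fun ⟨b, hb, h⟩ => FaithfulSMul.algebraMap_injective (𝓞 K) K h ▸ hb, fun h => ⟨a, h, rfl⟩⟩

/-! ### Unit classes as elements with prescribed annihilator -/

section UnitClasses

variable {K : Type*} [Field K] [NumberField K]

theorem rep_mem {B Q : FracIdeal K} (X : IdealQuotient B Q) : rep X ∈ B :=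
  (Submodule.mkQ_surjective _ X).choose.2

theorem mk_rep {B Q : FracIdeal K} (X : IdealQuotient B Q) :
    (Submodule.Quotient.mk ⟨rep X, rep_mem X⟩ : IdealQuotient B Q) = X :=
  (Submodule.mkQ_surjective _ X).choose_spec

theorem rep_mk_sub_mem {B Q : FracIdeal K} {x : K} (hx : x ∈ B) :
    rep (Submodule.Quotient.mk ⟨x, hx⟩ : IdealQuotient B Q) - x ∈ Q :=
  (mk_eq_mk_iff (𝔮 := Q) (⟨_, rep_mem _⟩ : (B : Submodule (𝓞 K) K)) ⟨x, hx⟩).1 (mk_rep _)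

theorem eq_of_rep_sub_mem {B Q : FracIdeal K} {X Y : IdealQuotient B Q} (h : rep X - rep Y ∈ Q) :
    X = Y := by
  rw [← mk_rep X, ← mk_rep Y]
  exact (mk_eq_mk_iff _ _).2 h

theorem smul_mem_of_mem {Q : FracIdeal K} {x : K} (a : 𝓞 K) (hx : x ∈ Q) :
    algebraMap (𝓞 K) K a * x ∈ Q := by
  rw [← Algebra.smul_def]; exact Submodule.smul_mem (Q : Submodule (𝓞 K) K) a hx

theorem mul_mem_of_mul_eq {I J L : FracIdeal K} (h : I * J = L) {x y : K} (hx : x ∈ I)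
    (hy : y ∈ J) : x * y ∈ L :=
  h ▸ FractionalIdeal.mul_mem_mul hx hy

theorem algebraMap_mul_mem {B Q : FracIdeal K} {q : Ideal (𝓞 K)} (hQ : B * (q : FracIdeal K) = Q)
    {u : 𝓞 K} (hu : u ∈ q) {z : K} (hz : z ∈ B) : algebraMap (𝓞 K) K u * z ∈ Q :=
  mul_mem_of_mul_eq (by rw [mul_comm, hQ]) (algebraMap_mem_coeIdeal_iff.2 hu) hz

/-- A class in `B / Bq` is a unit class if and only if its annihilator is `q`. -/
theorem mk_mem_unitClasses_iff {B Q : FracIdeal K} {q : Ideal (𝓞 K)} (hB : B ≠ 0) (hq : q ≠ ⊥)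
    (hQ : B * (q : FracIdeal K) = Q) {z : K} (hz : z ∈ B) :
    (Submodule.Quotient.mk ⟨z, hz⟩ : IdealQuotient B Q) ∈ unitClasses B Q ↔
      ∀ u : 𝓞 K, algebraMap (𝓞 K) K u * z ∈ Q ↔ u ∈ q := by
  have hq' := coeIdeal_ne_zero' (K := K) hq
  constructor
  · intro h u
    refine ⟨fun hu => ?_, fun hu => algebraMap_mul_mem hQ hu hz⟩
    -- An integer that kills a generator kills all of `B / Q`, so `u B ⊆ q B`, and `B` cancels.
    have hle : FractionalIdeal.spanSingleton (𝓞 K)⁰ (algebraMap (𝓞 K) K u) * B ≤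
        (q : FracIdeal K) * B := by
      rw [mul_comm (q : FracIdeal K), hQ, FractionalIdeal.spanSingleton_mul_le_iff]
      intro y hy
      have hmem : (Submodule.Quotient.mk ⟨y, hy⟩ : IdealQuotient B Q) ∈ Submodule.span (𝓞 K)
          {(Submodule.Quotient.mk ⟨z, hz⟩ : IdealQuotient B Q)} := by
        rw [show Submodule.span (𝓞 K) _ = ⊤ from h]; trivial
      obtain ⟨r, hr⟩ := Submodule.mem_span_singleton.1 hmem
      rw [← Submodule.Quotient.mk_smul, eq_comm, mk_eq_mk_iff] at hr
      have hr' : y - algebraMap (𝓞 K) K r * z ∈ Q := by rw [← Algebra.smul_def]; exact hr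
      have : algebraMap (𝓞 K) K u * y = algebraMap (𝓞 K) K u * (y - algebraMap (𝓞 K) K r * z) +
          algebraMap (𝓞 K) K r * (algebraMap (𝓞 K) K u * z) := by ring
      rw [this]
      exact Submodule.add_mem _ (smul_mem_of_mem _ hr') (smul_mem_of_mem _ hu)
    have h2 := (mul_le_mul_iff_left₀ (bot_lt_iff_ne_bot.2 hB)).1 hle
    exact algebraMap_mem_coeIdeal_iff.1 (h2 (FractionalIdeal.mem_spanSingleton_self _ _))
  · intro h
    -- To show that `z` generates, write `Q = j C` with `C = (z) + Q`. Then `j` kills `z` modulo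
    -- `Q`, so `j ⊆ q`; hence `B q = C j ⊆ C q` and `B ⊆ C`.
    set C := FractionalIdeal.spanSingleton (𝓞 K)⁰ z + Q with hC
    have hQ0 : Q ≠ 0 := hQ ▸ mul_ne_zero hB hq'
    have hQC : Q ≤ C := le_add_of_nonneg_left (by simp)
    have hC0 : C ≠ 0 := by
      intro h0
      rw [h0] at hQC
      exact hQ0 (le_antisymm hQC (by simp))
    obtain ⟨j, hj⟩ : ∃ j : Ideal (𝓞 K), (j : FracIdeal K) = Q * C⁻¹ := by
      refine FractionalIdeal.le_one_iff_exists_coeIdeal.1 ?_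
      rw [← mul_inv_cancel₀ hC0]
      exact mul_le_mul_left hQC _
    have hjC : (j : FracIdeal K) * C = Q := by
      rw [hj, mul_assoc, inv_mul_cancel₀ hC0, mul_one]
    have hzC : z ∈ C := (FractionalIdeal.mem_add _ _ _).2
      ⟨z, FractionalIdeal.mem_spanSingleton_self _ _, 0, Submodule.zero_mem _, add_zero z⟩
    have hjq : j ≤ q := fun u hu => (h u).1 (by
      rw [← hjC]; exact FractionalIdeal.mul_mem_mul (algebraMap_mem_coeIdeal_iff.2 hu) hzC)
    have hBC : B ≤ C := by
      have h1 : B * (q : FracIdeal K) ≤ C * (q : FracIdeal K) := by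
        rw [hQ, ← hjC, mul_comm C]
        exact mul_le_mul_left ((FractionalIdeal.coeIdeal_le_coeIdeal K).2 hjq) _
      exact (mul_le_mul_iff_left₀ (bot_lt_iff_ne_bot.2 hq')).1 h1
    refine eq_top_iff.2 fun Y _ => ?_
    rw [← mk_rep Y, Submodule.mem_span_singleton]
    obtain ⟨i, hi, t, ht, hsum⟩ := (FractionalIdeal.mem_add _ _ _).1 (hBC (rep_mem Y))
    obtain ⟨r, rfl⟩ := (FractionalIdeal.mem_spanSingleton _).1 hi
    refine ⟨r, ?_⟩
    rw [← Submodule.Quotient.mk_smul, eq_comm, mk_eq_mk_iff]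
    change rep Y - r • z ∈ Q
    rw [← hsum, add_sub_cancel_left]
    exact ht

theorem mem_unitClasses_iff {B Q : FracIdeal K} {q : Ideal (𝓞 K)} (hB : B ≠ 0) (hq : q ≠ ⊥)
    (hQ : B * (q : FracIdeal K) = Q) {X : IdealQuotient B Q} :
    X ∈ unitClasses B Q ↔ ∀ u : 𝓞 K, algebraMap (𝓞 K) K u * rep X ∈ Q ↔ u ∈ q := by
  rw [← mk_mem_unitClasses_iff hB hq hQ (rep_mem X), mk_rep]

theorem isInverseClass_invClass {B Q : FracIdeal K} (hB : B ≠ 0) {X : IdealQuotient B Q}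
    (hX : X ∈ unitClasses B Q) : IsInverseClass X (invClass X) := by
  have h := (existsUnique_inverseClass hB hX).exists
  rw [invClass, dif_pos h]
  exact h.choose_spec

theorem rep_mul_rep_invClass {B Q : FracIdeal K} (hB : B ≠ 0) {X : IdealQuotient B Q}
    (hX : X ∈ unitClasses B Q) : rep X * rep (invClass X) - 1 ∈ Q * B⁻¹ :=
  (isInverseClass_invClass hB hX).2 ⟨_, rep_mem X⟩ ⟨_, rep_mem _⟩ (mk_rep _) (mk_rep _)

/-- The congruence only has to be checked on one pair of representatives, because changing either
one moves the product by an element of `Q B⁻¹`. -/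
theorem isInverseClass_mk {B Q : FracIdeal K} (hB : B ≠ 0) {x z : K} (hx : x ∈ B) (hz : z ∈ B⁻¹)
    (hxz : x * z - 1 ∈ Q * B⁻¹)
    (hZ : (Submodule.Quotient.mk ⟨z, hz⟩ : IdealQuotient B⁻¹ (Q * (B⁻¹) ^ 2)) ∈
      unitClasses B⁻¹ (Q * (B⁻¹) ^ 2)) :
    IsInverseClass (Submodule.Quotient.mk ⟨x, hx⟩ : IdealQuotient B Q)
      (Submodule.Quotient.mk ⟨z, hz⟩) := by
  refine ⟨hZ, fun x' z' hx' hz' => ?_⟩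
  have h1 : (x' : K) - x ∈ Q := (mk_eq_mk_iff x' ⟨x, hx⟩).1 hx'
  have h2 : (z' : K) - z ∈ Q * (B⁻¹) ^ 2 := (mk_eq_mk_iff z' ⟨z, hz⟩).1 hz'
  have h3 : x * ((z' : K) - z) ∈ Q * B⁻¹ := by
    have : Q * B⁻¹ = B * (Q * (B⁻¹) ^ 2) := by
      rw [sq, mul_left_comm, ← mul_assoc B, mul_inv_cancel₀ hB, one_mul]
    rw [this]; exact FractionalIdeal.mul_mem_mul hx h2
  have : (x' : K) * z' - 1 = (x * z - 1) + (((x' : K) - x) * z' + x * ((z' : K) - z)) := by ring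
  rw [this]
  exact Submodule.add_mem _ hxz
    (Submodule.add_mem _ (FractionalIdeal.mul_mem_mul h1 z'.2) h3)

theorem annOf_mk_eq_iff {q : Ideal (𝓞 K)} {y : K} :
    annOf (Submodule.Quotient.mk y : DualQuotient K) = q ↔
      ∀ u : 𝓞 K, algebraMap (𝓞 K) K u * y ∈ (different K)⁻¹ ↔ u ∈ q := by
  rw [SetLike.ext_iff]
  refine forall_congr' fun u => ?_
  rw [mem_annOf, ← Submodule.Quotient.mk_smul, dualQuotient_mk_eq_zero, Algebra.smul_def]

theorem mul_mem_spanSingleton_mul_iff {I : FracIdeal K} {e y : K} (he : e ≠ 0) :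
    e * y ∈ FractionalIdeal.spanSingleton (𝓞 K)⁰ e * I ↔ y ∈ I := by
  rw [FractionalIdeal.mem_singleton_mul]
  exact ⟨fun ⟨z, hz, h⟩ => mul_left_cancel₀ he h ▸ hz, fun h => ⟨y, h, rfl⟩⟩

/-- The inverses of unit classes, rescaled into `K / 𝔇⁻¹`. -/
theorem bijOn_invClass {B Q : FracIdeal K} {q : Ideal (𝓞 K)} {e : K} (hB : B ≠ 0) (hq : q ≠ ⊥)
    (he0 : e ≠ 0) (hQ : B * (q : FracIdeal K) = Q)
    (he : FractionalIdeal.spanSingleton (𝓞 K)⁰ e * (different K)⁻¹ = Q * (B⁻¹) ^ 2) :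
    Set.BijOn (fun X : IdealQuotient B Q =>
        (Submodule.Quotient.mk (rep (invClass X) / e) : DualQuotient K))
      (unitClasses B Q) (primitiveFinset q) := by
  have hQ' : B⁻¹ * (q : FracIdeal K) = Q * (B⁻¹) ^ 2 := by
    rw [← hQ, sq, ← mul_assoc, mul_right_comm B, mul_inv_cancel₀ hB, one_mul, mul_comm]
  have hQB : Q * B⁻¹ = q := by rw [← hQ, mul_right_comm, mul_inv_cancel₀ hB, one_mul]
  have hscale : ∀ y : K, e * y ∈ Q * (B⁻¹) ^ 2 ↔ y ∈ (different K)⁻¹ := fun y => by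
    rw [← he, mul_mem_spanSingleton_mul_iff he0]
  have hscale' : ∀ z : K, z / e ∈ (different K)⁻¹ ↔ z ∈ Q * (B⁻¹) ^ 2 := fun z => by
    rw [← hscale, mul_div_cancel₀ _ he0]
  refine ⟨fun X hX => ?_, fun X hX X' hX' h => ?_, fun Y hY => ?_⟩
  · rw [Finset.mem_coe, mem_primitiveFinset hq, annOf_mk_eq_iff]
    intro u
    rw [← mul_div_assoc, hscale']
    exact (mem_unitClasses_iff (inv_ne_zero hB) hq hQ').1 (isInverseClass_invClass hB hX).1 u
  · dsimp only at h
    rw [Submodule.Quotient.eq, ← sub_div] at h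
    have hz := (hscale' _).1 h
    have hZ : invClass X = invClass X' := eq_of_rep_sub_mem hz
    have h1 := rep_mul_rep_invClass hB hX
    have h2 := rep_mul_rep_invClass hB hX'
    rw [← hZ] at h2
    refine eq_of_rep_sub_mem ?_
    -- Two classes with a common inverse `z` agree: `x - x' = x'(x z - 1) - x(x' z - 1)`.
    have : rep X - rep X' = rep X' * (rep X * rep (invClass X) - 1) -
        rep X * (rep X' * rep (invClass X) - 1) := by ring
    rw [this]
    have hBQ : B * (Q * B⁻¹) = Q := by rw [hQB, hQ]
    exact Submodule.sub_mem _ (mul_mem_of_mul_eq hBQ (rep_mem X') h1)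
      (mul_mem_of_mul_eq hBQ (rep_mem X) h2)
  · obtain ⟨y, rfl⟩ := Submodule.Quotient.mk_surjective _ Y
    rw [Finset.mem_coe, mem_primitiveFinset hq] at hY
    have hyq := (mk_mem_torsionBy hq).1 (mem_torsionBy.2 hY.dvd)
    have hz : e * y ∈ B⁻¹ := by
      have : B⁻¹ = FractionalIdeal.spanSingleton (𝓞 K)⁰ e * ((q : FracIdeal K) * different K)⁻¹ := by
        rw [mul_inv, mul_left_comm, he, ← hQ', mul_left_comm,
          inv_mul_cancel₀ (coeIdeal_ne_zero' hq), mul_one]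
      rw [this, mul_mem_spanSingleton_mul_iff he0]
      exact hyq
    have hZ : (Submodule.Quotient.mk ⟨e * y, hz⟩ : IdealQuotient B⁻¹ (Q * (B⁻¹) ^ 2)) ∈
        unitClasses B⁻¹ (Q * (B⁻¹) ^ 2) := by
      rw [mk_mem_unitClasses_iff (inv_ne_zero hB) hq hQ' hz]
      intro u
      rw [mul_left_comm, hscale]
      exact annOf_mk_eq_iff.1 hY u
    -- For surjectivity the class of `e y` is inverted in turn. Its inverse lives in `(B⁻¹)⁻¹ = B`,
    -- and uniqueness of inverses leads back to `e y`.
    obtain ⟨W, hW⟩ := (existsUnique_inverseClass (inv_ne_zero hB) hZ).exists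
    have hx : rep W ∈ B := by simpa using rep_mem W
    have hxz : rep W * (e * y) - 1 ∈ Q * B⁻¹ := by
      have h := hW.2 ⟨e * y, hz⟩ ⟨_, rep_mem W⟩ rfl (mk_rep W)
      have hQB' : Q * (B⁻¹) ^ 2 * (B⁻¹)⁻¹ = Q * B⁻¹ := by
        rw [sq, mul_assoc, mul_assoc B⁻¹, mul_inv_cancel₀ (inv_ne_zero hB), mul_one]
      rw [hQB'] at h
      rwa [mul_comm (rep W)]
    have hX : (Submodule.Quotient.mk ⟨rep W, hx⟩ : IdealQuotient B Q) ∈ unitClasses B Q := by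
      rw [mk_mem_unitClasses_iff hB hq hQ hx]
      refine fun u => ⟨fun hu => ?_, fun hu => algebraMap_mul_mem hQ hu hx⟩
      · rw [← algebraMap_mem_coeIdeal_iff (K := K), ← hQB]
        have : algebraMap (𝓞 K) K u = (algebraMap (𝓞 K) K u * rep W) * (e * y) -
            algebraMap (𝓞 K) K u * (rep W * (e * y) - 1) := by ring
        rw [this]
        exact Submodule.sub_mem _ (FractionalIdeal.mul_mem_mul hu hz) (smul_mem_of_mem _ hxz)
    refine ⟨_, hX, ?_⟩
    have hinv := (existsUnique_inverseClass hB hX).unique (isInverseClass_invClass hB hX)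
      (isInverseClass_mk hB hx hz hxz hZ)
    dsimp only
    rw [hinv, Submodule.Quotient.eq]
    have := (hscale' _).2 (rep_mk_sub_mem (Q := Q * (B⁻¹) ^ 2) hz)
    rwa [sub_div, mul_div_cancel_left₀ _ he0] at this

end UnitClasses

/-! ### The Kloosterman sum over `K / 𝔇⁻¹` -/

section Kloosterman

variable {K : Type*} [Field K] [NumberField K]

/-- The exponent of an integral ideal at a place. -/
def ordIdeal (v : HeightOneSpectrum (𝓞 K)) (I : Ideal (𝓞 K)) : ℤ :=
  FractionalIdeal.count K v (I : FracIdeal K)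

theorem ordIdeal_nonneg (v : HeightOneSpectrum (𝓞 K)) (I : Ideal (𝓞 K)) : 0 ≤ ordIdeal v I :=
  FractionalIdeal.count_coe_nonneg K v I

theorem ordIdeal_eq_zero {v : HeightOneSpectrum (𝓞 K)} {I : Ideal (𝓞 K)} (hI : I ≠ ⊥)
    (h : ¬ v.asIdeal ∣ I) : ordIdeal v I = 0 :=
  count_eq_zero_of_not_dvd hI h

theorem ordIdeal_le {v : HeightOneSpectrum (𝓞 K)} {I J : Ideal (𝓞 K)} (hI : I ≠ ⊥) (h : J ∣ I) :
    ordIdeal v J ≤ ordIdeal v I :=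
  count_le_of_dvd hI h

theorem ordIdeal_mul {v : HeightOneSpectrum (𝓞 K)} {I J : Ideal (𝓞 K)} (hI : I ≠ ⊥) (hJ : J ≠ ⊥) :
    ordIdeal v (I * J) = ordIdeal v I + ordIdeal v J := by
  rw [ordIdeal, FractionalIdeal.coeIdeal_mul,
    FractionalIdeal.count_mul K v (coeIdeal_ne_zero' hI) (coeIdeal_ne_zero' hJ)]
  rfl

theorem mem_mul_different_inv_iff {q : Ideal (𝓞 K)} (hq : q ≠ ⊥) {y : K} :
    y ∈ ((q : FracIdeal K) * different K)⁻¹ ↔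
      ∀ v : HeightOneSpectrum (𝓞 K), OrdGe v (-ordIdeal v q - ordDiff K v) y := by
  have hq' := coeIdeal_ne_zero' (K := K) hq
  rw [mem_iff_ordGe (inv_ne_zero (mul_ne_zero hq' different_ne_zero))]
  refine forall_congr' fun v => ?_
  rw [FractionalIdeal.count_inv, FractionalIdeal.count_mul K v hq' different_ne_zero, neg_add,
    ← sub_eq_add_neg]
  rfl

theorem mem_partAt_different_inv_iff {b : Ideal (𝓞 K)} (hb : b ≠ ⊥) {x : K} :
    x ∈ (partAt (different K) b)⁻¹ ↔ ∀ v : HeightOneSpectrum (𝓞 K),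
      (v.asIdeal ∣ b → OrdGe v (-ordDiff K v) x) ∧ (¬ v.asIdeal ∣ b → OrdGe v 0 x) := by
  rw [mem_iff_ordGe (inv_ne_zero (partAt_ne_zero _ _))]
  refine forall_congr' fun v => ?_
  rw [FractionalIdeal.count_inv]
  by_cases hv : v.asIdeal ∣ b
  · simp [hv, (count_partAt (different K) hb v).1 hv, ordDiff]
  · simp [hv, (count_partAt (different K) hb v).2 hv]

theorem mem_mul_partAt_different_iff {b q : Ideal (𝓞 K)} (hb : b ≠ ⊥) (hq : q ∣ b) {x : K} :
    x ∈ (q : FracIdeal K) * partAt (different K) b ↔ ∀ v : HeightOneSpectrum (𝓞 K),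
      (v.asIdeal ∣ b → OrdGe v (ordIdeal v q + ordDiff K v) x) ∧
        (¬ v.asIdeal ∣ b → OrdGe v 0 x) := by
  have hq0 := ne_bot_of_dvd hb hq
  have hq' := coeIdeal_ne_zero' (K := K) hq0
  rw [mem_iff_ordGe (mul_ne_zero hq' (partAt_ne_zero _ _))]
  refine forall_congr' fun v => ?_
  rw [FractionalIdeal.count_mul K v hq' (partAt_ne_zero _ _)]
  by_cases hv : v.asIdeal ∣ b
  · simp [hv, (count_partAt (different K) hb v).1 hv, ordDiff, ordIdeal]
  · simp [hv, (count_partAt (different K) hb v).2 hv,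
      count_eq_zero_of_not_dvd hq0 fun h => hv (h.trans hq)]

theorem mem_mul_partAt_different_inv_iff {b q : Ideal (𝓞 K)} (hb : b ≠ ⊥) (hq : q ∣ b) {x : K} :
    x ∈ ((q : FracIdeal K) * partAt (different K) b)⁻¹ ↔ ∀ v : HeightOneSpectrum (𝓞 K),
      (v.asIdeal ∣ b → OrdGe v (-ordIdeal v q - ordDiff K v) x) ∧
        (¬ v.asIdeal ∣ b → OrdGe v 0 x) := by
  have hq0 := ne_bot_of_dvd hb hq
  have hq' := coeIdeal_ne_zero' (K := K) hq0
  rw [mem_iff_ordGe (inv_ne_zero (mul_ne_zero hq' (partAt_ne_zero _ _)))]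
  refine forall_congr' fun v => ?_
  rw [FractionalIdeal.count_inv, FractionalIdeal.count_mul K v hq' (partAt_ne_zero _ _), neg_add,
    ← sub_eq_add_neg]
  by_cases hv : v.asIdeal ∣ b
  · simp [hv, (count_partAt (different K) hb v).1 hv, ordDiff, ordIdeal]
  · simp [hv, (count_partAt (different K) hb v).2 hv,
      count_eq_zero_of_not_dvd hq0 fun h => hv (h.trans hq)]

/-- At primes not dividing `b` such an `x` is integral, so both conditions hold there; at primes
dividing `b` they coincide. Hence the map to `K / 𝔇⁻¹` is injective. -/
theorem mem_partAt_inv_iff_mem_different_inv {b q : Ideal (𝓞 K)} (hb : b ≠ ⊥) (hq : q ∣ b) {x : K}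
    (hx : x ∈ ((q : FracIdeal K) * partAt (different K) b)⁻¹) :
    x ∈ (partAt (different K) b)⁻¹ ↔ x ∈ (different K)⁻¹ := by
  rw [mem_partAt_different_inv_iff hb, mem_different_inv_iff_ordGe]
  rw [mem_mul_partAt_different_inv_iff hb hq] at hx
  refine forall_congr' fun v => ⟨fun h => ?_, fun h => ⟨fun _ => h, (hx v).2⟩⟩
  by_cases hv : v.asIdeal ∣ b
  · exact h.1 hv
  · exact (h.2 hv).mono (neg_nonpos.2 (ordDiff_nonneg v))

theorem mul_partAt_inv_mul {b q : Ideal (𝓞 K)} (hq : q ≠ ⊥) :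
    ((q : FracIdeal K) * partAt (different K) b)⁻¹ * (q : FracIdeal K) =
      (partAt (different K) b)⁻¹ := by
  rw [mul_inv, mul_right_comm, inv_mul_cancel₀ (coeIdeal_ne_zero' hq), one_mul]

theorem bijOn_rep {b q : Ideal (𝓞 K)} (hb : b ≠ ⊥) (hq : q ∣ b) :
    Set.BijOn (fun X : IdealQuotient ((q : FracIdeal K) * partAt (different K) b)⁻¹
        (partAt (different K) b)⁻¹ => (Submodule.Quotient.mk (rep X) : DualQuotient K))
      (unitClasses ((q : FracIdeal K) * partAt (different K) b)⁻¹ (partAt (different K) b)⁻¹)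
      (primitiveFinset q) := by
  have hq0 := ne_bot_of_dvd hb hq
  have hB : ((q : FracIdeal K) * partAt (different K) b)⁻¹ ≠ 0 :=
    inv_ne_zero (mul_ne_zero (coeIdeal_ne_zero' hq0) (partAt_ne_zero _ _))
  have hQ := mul_partAt_inv_mul (b := b) hq0
  refine ⟨fun X hX => ?_, fun X hX X' hX' h => ?_, fun Y hY => ?_⟩
  · rw [Finset.mem_coe, mem_primitiveFinset hq0, annOf_mk_eq_iff]
    intro u
    rw [← mem_partAt_inv_iff_mem_different_inv hb hq (smul_mem_of_mem u (rep_mem X))]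
    exact (mem_unitClasses_iff hB hq0 hQ).1 hX u
  · dsimp only at h
    rw [Submodule.Quotient.eq] at h
    exact eq_of_rep_sub_mem ((mem_partAt_inv_iff_mem_different_inv hb hq
      (Submodule.sub_mem _ (rep_mem X) (rep_mem X'))).2 h)
  · obtain ⟨y, rfl⟩ := Submodule.Quotient.mk_surjective _ Y
    rw [Finset.mem_coe, mem_primitiveFinset hq0] at hY
    have hyq := (mem_mul_different_inv_iff hq0).1
      ((mk_mem_torsionBy hq0).1 (mem_torsionBy.2 hY.dvd))
    -- A representative `y` of a torsion class may have poles away from `b`, bounded by the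
    -- different. Replacing it by an `x` integral there changes it only by an element of `𝔇⁻¹`.
    obtain ⟨x, hx1, hx2⟩ := exists_approx {v | v.asIdeal ∣ b} (partAt (different K) b)⁻¹ y
    replace hx1 : ∀ v : HeightOneSpectrum (𝓞 K), v.asIdeal ∣ b → OrdGe v (-ordDiff K v) (x - y) := by
      intro v hv
      have := hx1 v hv
      rwa [FractionalIdeal.count_inv, (count_partAt _ hb v).1 hv] at this
    replace hx2 : ∀ v : HeightOneSpectrum (𝓞 K), ¬ v.asIdeal ∣ b → OrdGe v 0 x := by
      intro v hv
      have := hx2 v hv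
      rwa [FractionalIdeal.count_inv, (count_partAt _ hb v).2 hv, neg_zero] at this
    have hxB : x ∈ ((q : FracIdeal K) * partAt (different K) b)⁻¹ := by
      rw [mem_mul_partAt_different_inv_iff hb hq]
      refine fun v => ⟨fun hv => ?_, hx2 v⟩
      have := ((hx1 v hv).mono (m := -ordIdeal v q - ordDiff K v)
        (by linarith [ordIdeal_nonneg v q])).add (hyq v)
      rwa [sub_add_cancel] at this
    have hxy : x - y ∈ (different K)⁻¹ := by
      rw [mem_different_inv_iff_ordGe]
      intro v
      by_cases hv : v.asIdeal ∣ b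
      · exact hx1 v hv
      · have := hyq v
        rw [ordIdeal_eq_zero hq0 fun h => hv (h.trans hq), neg_zero, zero_sub] at this
        exact ((hx2 v hv).mono (neg_nonpos.2 (ordDiff_nonneg v))).sub this
    have hmk : (Submodule.Quotient.mk x : DualQuotient K) = Submodule.Quotient.mk y :=
      (Submodule.Quotient.eq _).2 hxy
    refine ⟨Submodule.Quotient.mk ⟨x, hxB⟩, ?_, ?_⟩
    · rw [mk_mem_unitClasses_iff hB hq0 hQ]
      intro u
      rw [mem_partAt_inv_iff_mem_different_inv hb hq (smul_mem_of_mem u hxB)]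
      rw [← hmk] at hY
      exact annOf_mk_eq_iff.1 hY u
    · dsimp only
      rw [← hmk, Submodule.Quotient.eq]
      have h := rep_mk_sub_mem (Q := (partAt (different K) b)⁻¹) hxB
      exact (mem_partAt_inv_iff_mem_different_inv hb hq
        (Submodule.sub_mem _ (rep_mem _) hxB)).1 h

/-- A multiplier `w` that represents `δ x⁻¹` modulo `q` at the primes dividing `b`, and `0` at the
other primes. -/
structure IsMultiplier (b q q₁ : Ideal (𝓞 K)) (δ x : K) (w : 𝓞 K) : Prop where
  ordGe_of_not_dvd : ∀ v : HeightOneSpectrum (𝓞 K), ¬ v.asIdeal ∣ b →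
    OrdGe v (ordIdeal v q) (algebraMap (𝓞 K) K w)
  ordGe_of_dvd : ∀ v : HeightOneSpectrum (𝓞 K), v.asIdeal ∣ b →
    OrdGe v (ordIdeal v q - ordIdeal v q₁) (algebraMap (𝓞 K) K w)
  mul_sub : ∀ v : HeightOneSpectrum (𝓞 K), v.asIdeal ∣ b →
    OrdGe v (ordIdeal v q - ordIdeal v q₁ - ordDiff K v) (algebraMap (𝓞 K) K w * x - δ)

/-- With `z = x⁻¹`, choose `w` close to `δ z` modulo `q` at the primes of `b` and close to `0`
elsewhere. Since `y` has denominator at most `q𝔇`, the error `(w - δ z) y` is invisible to `ψ_b`,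
and `w y` lies in `𝔇⁻¹` away from `b`; thus `ψ_b` at `-δ y z` becomes `e(-Tr wy)`. The lower bound
on the order of `δ` is what makes `w` integral. -/
theorem exists_multiplier {b q q₁ : Ideal (𝓞 K)} (hb : b ≠ ⊥) (hq : q ≠ ⊥) (hq₁ : q₁ ∣ b)
    (hbq : b ∣ q) {δ : K} (hδ : ∀ v : HeightOneSpectrum (𝓞 K), v.asIdeal ∣ b →
      OrdGe v (ordIdeal v q - 2 * ordIdeal v q₁ - ordDiff K v) δ)
    {X : IdealQuotient ((q₁ : FracIdeal K) * partAt (different K) b)⁻¹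
      (partAt (different K) b)⁻¹}
    (hX : X ∈ unitClasses ((q₁ : FracIdeal K) * partAt (different K) b)⁻¹
      (partAt (different K) b)⁻¹) :
    ∃ w : 𝓞 K, IsMultiplier b q q₁ δ (rep X) w ∧ ∀ y ∈ ((q : FracIdeal K) * different K)⁻¹,
      psiIdeal b (1 * rep X + -(δ * y) * rep (invClass X)) =
        traceChar (rep X) * traceChar (-(algebraMap (𝓞 K) K w * y)) := by
  have hq₁0 := ne_bot_of_dvd hb hq₁
  have hB : ((q₁ : FracIdeal K) * partAt (different K) b)⁻¹ ≠ 0 :=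
    inv_ne_zero (mul_ne_zero (coeIdeal_ne_zero' hq₁0) (partAt_ne_zero _ _))
  have hx := (mem_mul_partAt_different_inv_iff hb hq₁).1 (rep_mem X)
  have hz : ∀ v : HeightOneSpectrum (𝓞 K),
      (v.asIdeal ∣ b → OrdGe v (ordIdeal v q₁ + ordDiff K v) (rep (invClass X))) ∧
        (¬ v.asIdeal ∣ b → OrdGe v 0 (rep (invClass X))) := by
    rw [← mem_mul_partAt_different_iff hb hq₁]
    simpa using rep_mem (invClass X)
  have hxz : rep X * rep (invClass X) - 1 ∈ (q₁ : FracIdeal K) := by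
    have h := rep_mul_rep_invClass hB hX
    have heq : (partAt (different K) b)⁻¹ * ((q₁ : FracIdeal K) * partAt (different K) b)⁻¹⁻¹ =
        q₁ := by
      rw [inv_inv, mul_left_comm, inv_mul_cancel₀ (partAt_ne_zero _ _), mul_one]
    rwa [heq] at h
  rw [mem_coeIdeal_iff_ordGe hq₁0] at hxz
  set x := rep X
  set z := rep (invClass X)
  have hqq : ∀ v : HeightOneSpectrum (𝓞 K), ordIdeal v q₁ ≤ ordIdeal v q :=
    fun v => ordIdeal_le hq (hq₁.trans hbq)
  have hδz : ∀ v : HeightOneSpectrum (𝓞 K), v.asIdeal ∣ b →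
      OrdGe v (ordIdeal v q - ordIdeal v q₁) (δ * z) := fun v hv =>
    ((hδ v hv).mul ((hz v).1 hv)).mono (by linarith)
  obtain ⟨w₀, hw1, hw2⟩ := exists_approx {v | v.asIdeal ∣ b} (q : FracIdeal K) (δ * z)
  replace hw1 : ∀ v : HeightOneSpectrum (𝓞 K), v.asIdeal ∣ b →
    OrdGe v (ordIdeal v q) (w₀ - δ * z) := hw1
  replace hw2 : ∀ v : HeightOneSpectrum (𝓞 K), ¬ v.asIdeal ∣ b → OrdGe v (ordIdeal v q) w₀ := hw2
  have hw3 : ∀ v : HeightOneSpectrum (𝓞 K), v.asIdeal ∣ b →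
      OrdGe v (ordIdeal v q - ordIdeal v q₁) w₀ := fun v hv => by
    have := ((hw1 v hv).mono (by linarith [ordIdeal_nonneg v q₁])).add (hδz v hv)
    rwa [sub_add_cancel] at this
  obtain ⟨w, rfl⟩ := HeightOneSpectrum.mem_integers_of_valuation_le_one (R := 𝓞 K) K w₀ fun v => by
    rw [← ordGe_zero_iff]
    by_cases hv : v.asIdeal ∣ b
    · exact (hw3 v hv).mono (by linarith [hqq v])
    · exact (hw2 v hv).mono (ordIdeal_nonneg v q)
  refine ⟨w, ⟨hw2, hw3, fun v hv => ?_⟩, fun y hy => ?_⟩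
  · have h1 := (hw1 v hv).mul ((hx v).1 hv)
    -- The two errors come from `w x - δ = (w - δ z) x + δ (x z - 1)`.
    have h2 := (hδ v hv).mul (hxz v)
    have := (h1.mono (m := ordIdeal v q - ordIdeal v q₁ - ordDiff K v) (by linarith)).add
      (h2.mono (by
        change _ ≤ ordIdeal v q - 2 * ordIdeal v q₁ - ordDiff K v + ordIdeal v q₁
        linarith))
    convert this using 1
    ring
  · rw [mem_mul_different_inv_iff hq] at hy
    have hsplit : -(δ * y) * z = -(algebraMap (𝓞 K) K w * y) +
      (algebraMap (𝓞 K) K w - δ * z) * y := by ring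
    rw [psiIdeal_add hb, one_mul, hsplit, psiIdeal_add hb,
      psiIdeal_eq_one (x := (algebraMap (𝓞 K) K w - δ * z) * y) fun v hv =>
        ((hw1 v hv).mul (hy v)).mono (by linarith), mul_one,
      psiIdeal_eq_traceChar fun v hv =>
        ((hx v).2 hv).mono (neg_nonpos.2 (ordDiff_nonneg v)),
      psiIdeal_eq_traceChar fun v hv => ((hw2 v hv).mul (hy v)).neg.mono (by linarith)]

/-- The multipliers are chosen once for all `y`, which is what later permits the exchange of the two
sums. -/
theorem exists_kloosterman_eq {b q q₁ : Ideal (𝓞 K)} (hb : b ≠ ⊥) (hq : q ≠ ⊥) (hq₁ : q₁ ∣ b)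
    (hbq : b ∣ q) {δ : K} (hδ : ∀ v : HeightOneSpectrum (𝓞 K), v.asIdeal ∣ b →
      OrdGe v (ordIdeal v q - 2 * ordIdeal v q₁ - ordDiff K v) δ) :
    ∃ w : DualQuotient K → 𝓞 K,
      (∀ X ∈ primitiveFinset q₁, ∃ x : K, Submodule.Quotient.mk x = X ∧
        IsMultiplier b q q₁ δ x (w X)) ∧
      ∀ y ∈ ((q : FracIdeal K) * different K)⁻¹, kloosterman b 1 (-(δ * y)) q₁ =
        ∑ X ∈ primitiveFinset q₁,
          quotChar X * quotChar (-(w X • (Submodule.Quotient.mk y : DualQuotient K))) := by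
  classical
  have hbij := bijOn_rep hb hq₁
  have hex : ∀ Y : DualQuotient K, ∃ w : 𝓞 K, Y ∈ primitiveFinset q₁ →
      ∃ X ∈ unitClasses ((q₁ : FracIdeal K) * partAt (different K) b)⁻¹
          (partAt (different K) b)⁻¹,
        Submodule.Quotient.mk (rep X) = Y ∧ IsMultiplier b q q₁ δ (rep X) w ∧
        ∀ y ∈ ((q : FracIdeal K) * different K)⁻¹,
          psiIdeal b (1 * rep X + -(δ * y) * rep (invClass X)) =
            traceChar (rep X) * traceChar (-(algebraMap (𝓞 K) K w * y)) := by
    intro Y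
    by_cases hY : Y ∈ primitiveFinset q₁
    · obtain ⟨X, hX, hXY⟩ := hbij.surjOn hY
      obtain ⟨w, hw⟩ := exists_multiplier hb hq hq₁ hbq hδ hX
      exact ⟨w, fun _ => ⟨X, hX, hXY, hw⟩⟩
    -- The value away from the classes with annihilator `q₁` plays no role.
    · exact ⟨0, fun h => absurd h hY⟩
  choose w hw using hex
  refine ⟨w, fun Y hY => ?_, fun y hy => ?_⟩
  · obtain ⟨X, -, hXY, hmul, -⟩ := hw Y hY
    exact ⟨rep X, hXY, hmul⟩
  · rw [kloosterman, finsum_mem_eq_of_bijOn _ hbij (g := fun Y =>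
      quotChar Y * quotChar (-(w Y • (Submodule.Quotient.mk y : DualQuotient K))))]
    · exact finsum_mem_coe_finset _ _
    · intro X hX
      obtain ⟨X', hX', hXX', -, h⟩ := hw _ (hbij.mapsTo hX)
      obtain rfl := hbij.injOn hX' hX hXX'
      rw [h y hy, quotChar_mk, ← Submodule.Quotient.mk_smul, ← Submodule.Quotient.mk_neg,
        quotChar_mk, Algebra.smul_def]

end Kloosterman

/-! ### Evaluation of the Ramanujan sum and of the remaining sum -/

section Evaluation

variable {K : Type*} [Field K] [NumberField K]

theorem ordGe_one_iff {v : HeightOneSpectrum (𝓞 K)} {a : 𝓞 K} :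
    OrdGe v 1 (algebraMap (𝓞 K) K a) ↔ a ∈ v.asIdeal := by
  rw [OrdGe, HeightOneSpectrum.valuation_of_algebraMap]
  simpa using v.intValuation_le_pow_iff_mem a 1

theorem one_le_ordIdeal {v : HeightOneSpectrum (𝓞 K)} {I : Ideal (𝓞 K)} (hI : I ≠ ⊥)
    (h : v.asIdeal ∣ I) : 1 ≤ ordIdeal v I :=
  (count_pos_iff hI).2 h

theorem not_dvd_of_one_add_mem {v : HeightOneSpectrum (𝓞 K)} {k : Ideal (𝓞 K)} {w : 𝓞 K}
    (hw : w ∈ v.asIdeal) (hk : -(1 + w) ∈ k) : ¬ v.asIdeal ∣ k := by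
  intro h
  have h1 := Ideal.dvd_iff_le.1 h hk
  have h2 := v.asIdeal.add_mem h1 hw
  rw [neg_add, neg_add_cancel_right] at h2
  exact v.isPrime.ne_top ((Ideal.eq_top_iff_one _).2 (neg_mem_iff.1 h2))

theorem sq_dvd_idealDiv {v : HeightOneSpectrum (𝓞 K)} {q k : Ideal (𝓞 K)} (hk : k ∣ q)
    (hvk : ¬ v.asIdeal ∣ k) (h : v.asIdeal ^ 2 ∣ q) : v.asIdeal ^ 2 ∣ idealDiv q k := by
  rw [← idealDiv_mul_cancel hk] at h
  exact (isCoprime_of_prime_not_dvd v.prime hvk).pow_left.dvd_of_dvd_mul_left h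

/-- The order of `w` at `v` is at least that of `q / q₁`, whether or not `v` divides `b`. -/
theorem IsMultiplier.mem_of_dvd {b q q₁ : Ideal (𝓞 K)} {δ x : K} {w : 𝓞 K}
    (h : IsMultiplier b q q₁ δ x w) (hq : q ≠ ⊥) (hq₁ : q₁ ∣ q) {v : HeightOneSpectrum (𝓞 K)}
    (hv : v.asIdeal ∣ idealDiv q q₁) : w ∈ v.asIdeal := by
  have hr := one_le_ordIdeal (ne_bot_of_dvd hq (idealDiv_dvd hq₁)) hv
  have hmul := ordIdeal_mul (v := v) (ne_bot_of_dvd hq hq₁) (ne_bot_of_dvd hq (idealDiv_dvd hq₁))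
  rw [idealDiv_mul_cancel hq₁] at hmul
  rw [← ordGe_one_iff (K := K)]
  by_cases hvb : v.asIdeal ∣ b
  · exact (h.ordGe_of_dvd v hvb).mono (by linarith)
  · exact (h.ordGe_of_not_dvd v hvb).mono (by linarith [ordIdeal_nonneg v q₁])

open scoped Classical in
-- A prime `v` dividing both `q₁` and `q / q₁` contains `w`, so it divides no `k` containing `1 +
-- w`. As `v² ∣ q`, also `v² ∣ q / k`, and the Möbius factor vanishes.
theorem ramanujan_eq_zero {b q q₁ : Ideal (𝓞 K)} {δ x : K} {w : 𝓞 K}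
    (h : IsMultiplier b q q₁ δ x w) (hq : q ≠ ⊥) (hq₁ : q₁ ∣ q)
    (hcop : ¬ IsCoprime q₁ (idealDiv q q₁)) :
    (∑ k ∈ idealDivisors q, if -(1 + w) ∈ k then
      (idealMoebius (idealDiv q k) : ℂ) * (Ideal.absNorm k : ℂ) else 0) = 0 := by
  rw [isCoprime_iff_forall_prime] at hcop
  push Not at hcop
  obtain ⟨v, hv1, hv2⟩ := hcop
  have hsq : v.asIdeal ^ 2 ∣ q := by
    rw [← idealDiv_mul_cancel hq₁, sq]; exact mul_dvd_mul hv1 hv2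
  refine Finset.sum_eq_zero fun k hk => ?_
  rw [mem_idealDivisors hq] at hk
  split_ifs with hwk
  · rw [idealMoebius_eq_zero_of_sq_dvd v.prime
      (sq_dvd_idealDiv hk (not_dvd_of_one_add_mem (h.mem_of_dvd hq hq₁ hv2) hwk) hsq)]
    simp
  · rfl

open scoped Classical in
-- A divisor `k` containing `1 + w` is coprime to `q / q₁`, hence divides `q₁`. Then `q / k` is the
-- product of the coprime ideals `q₁ / k` and `q / q₁`.
theorem ramanujan_eq_of_isCoprime {b q q₁ : Ideal (𝓞 K)} {δ x : K} {w : 𝓞 K}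
    (h : IsMultiplier b q q₁ δ x w) (hq : q ≠ ⊥) (hq₁ : q₁ ∣ q)
    (hcop : IsCoprime q₁ (idealDiv q q₁)) :
    (∑ k ∈ idealDivisors q, if -(1 + w) ∈ k then
      (idealMoebius (idealDiv q k) : ℂ) * (Ideal.absNorm k : ℂ) else 0) =
    (idealMoebius (idealDiv q q₁) : ℂ) * ∑ k ∈ idealDivisors q₁, if -(1 + w) ∈ k then
      (idealMoebius (idealDiv q₁ k) : ℂ) * (Ideal.absNorm k : ℂ) else 0 := by
  have hq₁0 := ne_bot_of_dvd hq hq₁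
  rw [Finset.mul_sum]
  symm
  rw [← Finset.sum_subset (s₁ := idealDivisors q₁) (s₂ := idealDivisors q)]
  · refine Finset.sum_congr rfl fun k hk => ?_
    rw [mem_idealDivisors hq₁0] at hk
    have hdiv : idealDiv q k = idealDiv q₁ k * idealDiv q q₁ :=
      idealDiv_eq_of_mul_eq (ne_bot_of_dvd hq₁0 hk) (by
        rw [← mul_assoc, idealDiv_mul_cancel hk, idealDiv_mul_cancel hq₁])
    have hc : IsCoprime (idealDiv q₁ k) (idealDiv q q₁) :=
      hcop.of_isCoprime_of_dvd_left (idealDiv_dvd hk)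
    rw [hdiv, idealMoebius_mul hc, mul_ite, mul_zero]
    push_cast
    congr 1
    ring
  · intro k hk
    rw [mem_idealDivisors hq₁0] at hk
    exact (mem_idealDivisors hq).2 (hk.trans hq₁)
  · intro k hk hk'
    rw [mem_idealDivisors hq] at hk
    rw [mem_idealDivisors hq₁0] at hk'
    refine if_neg fun hwk => hk' ?_
    have hkr : IsCoprime k (idealDiv q q₁) := isCoprime_iff_forall_prime.2 fun v hvk hvr =>
      not_dvd_of_one_add_mem (h.mem_of_dvd hq hq₁ hvr) hwk hvk
    rw [← idealDiv_mul_cancel hq₁] at hk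
    exact hkr.dvd_of_dvd_mul_right hk

/-- `δ₀` agrees with `δ` modulo `𝔇⁻¹` at the primes dividing `q₁`, and lies in `𝔇⁻¹` at the other
primes. -/
structure IsLocalPart (q₁ : Ideal (𝓞 K)) (δ δ₀ : K) : Prop where
  sub : ∀ v : HeightOneSpectrum (𝓞 K), v.asIdeal ∣ q₁ → OrdGe v (-ordDiff K v) (δ₀ - δ)
  ordGe : ∀ v : HeightOneSpectrum (𝓞 K), ¬ v.asIdeal ∣ q₁ → OrdGe v (-ordDiff K v) δ₀

theorem exists_isLocalPart (q₁ : Ideal (𝓞 K)) (δ : K) : ∃ δ₀ : K, IsLocalPart q₁ δ δ₀ := by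
  obtain ⟨δ₀, h1, h2⟩ := exists_approx {v | v.asIdeal ∣ q₁} (different K)⁻¹ δ
  simp only [FractionalIdeal.count_inv] at h1 h2
  exact ⟨δ₀, h1, h2⟩

/-- By coprimality `q` and `q₁` have the same order at each prime of `q₁`, so there `w x` agrees
with `δ` modulo `𝔇⁻¹`; at other primes both sides are in `𝔇⁻¹`. The product is therefore the same
for every `x`, although `w` itself varies with `x`. -/
theorem IsMultiplier.smul_mk {b q q₁ : Ideal (𝓞 K)} {δ δ₀ x : K} {w : 𝓞 K}
    (h : IsMultiplier b q q₁ δ x w) (hδ₀ : IsLocalPart q₁ δ δ₀) (hq : q ≠ ⊥) (hq₁ : q₁ ∣ b)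
    (hbq : b ∣ q) (hcop : IsCoprime q₁ (idealDiv q q₁))
    (hx : (Submodule.Quotient.mk x : DualQuotient K) ∈ primitiveFinset q₁) :
    w • (Submodule.Quotient.mk x : DualQuotient K) = Submodule.Quotient.mk δ₀ := by
  have hq₁q := hq₁.trans hbq
  have hq₁0 := ne_bot_of_dvd hq hq₁q
  have hx' := (mem_mul_different_inv_iff hq₁0).1 ((mk_mem_torsionBy hq₁0).1
    (mem_torsionBy.2 ((mem_primitiveFinset hq₁0).1 hx).dvd))
  rw [← Submodule.Quotient.mk_smul, Submodule.Quotient.eq, Algebra.smul_def]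
  refine mem_different_inv_iff_ordGe.2 fun v => ?_
  by_cases hv : v.asIdeal ∣ q₁
  · have hmul := ordIdeal_mul (v := v) hq₁0 (ne_bot_of_dvd hq (idealDiv_dvd hq₁q))
    rw [idealDiv_mul_cancel hq₁q, ordIdeal_eq_zero (ne_bot_of_dvd hq (idealDiv_dvd hq₁q))
      (isCoprime_iff_forall_prime.1 hcop v hv)] at hmul
    have := ((h.mul_sub v (hv.trans hq₁)).mono (m := -ordDiff K v) (by linarith)).sub
      (hδ₀.sub v hv)
    rwa [sub_sub_sub_cancel_right] at this
  · have h1 := hx' v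
    rw [ordIdeal_eq_zero hq₁0 hv] at h1
    exact (((OrdGe.algebraMap w).mul h1).mono (by linarith)).sub (hδ₀.ordGe v hv)

/-- Since `X` has annihilator `q₁`, the class `(1 + w) X` is killed by `q₁ / g` exactly when `(1 +
w)(q₁ / g) ⊆ q₁`. -/
theorem add_smul_mem_torsionBy_iff {q₁ g : Ideal (𝓞 K)} {X : DualQuotient K} {w : 𝓞 K}
    (hq₁ : q₁ ≠ ⊥) (hg : g ∣ q₁) (hX : annOf X = q₁) :
    X + w • X ∈ torsionBy (idealDiv q₁ g) ↔ -(1 + w) ∈ g := by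
  have hf := ne_bot_of_dvd hq₁ (idealDiv_dvd hg)
  have h1 : X + w • X = (1 + w) • X := by rw [add_smul, one_smul]
  rw [neg_mem_iff, h1, mem_torsionBy', ← Ideal.span_singleton_le_iff_mem, ← Ideal.dvd_iff_le,
    ← mul_dvd_mul_iff_right hf, idealDiv_mul_cancel hg, Ideal.dvd_iff_le,
    Ideal.span_singleton_mul_le_iff]
  refine forall₂_congr fun a _ => ?_
  rw [smul_smul, ← mem_annOf, hX, mul_comm]

open scoped Classical in
/-- The sum over pairs of divisors that results from two Möbius inversions. -/
theorem sum_primitive_shift {q₁ : Ideal (𝓞 K)} (hq₁ : q₁ ≠ ⊥) (Δ : DualQuotient K) :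
    ∑ X ∈ primitiveFinset q₁, quotChar X * ∑ g ∈ idealDivisors q₁,
      (if X + Δ ∈ torsionBy (idealDiv q₁ g) then
        (idealMoebius (idealDiv q₁ g) : ℂ) * (Ideal.absNorm g : ℂ) else 0) =
    ∑ p ∈ idealDivisors q₁ ×ˢ idealDivisors q₁,
      (idealMoebius (idealDiv q₁ p.1) : ℂ) * (idealMoebius p.2 : ℂ) *
        (Ideal.absNorm (idealDiv q₁ p.2) : ℂ) *
        ∑ X ∈ torsionFinset p.1 with X + Δ ∈ torsionBy p.2, quotChar X := by
  -- The substitution `f = q₁ / g` makes the torsion condition depend on `f` itself.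
  have h1 : ∀ X : DualQuotient K, ∑ g ∈ idealDivisors q₁,
      (if X + Δ ∈ torsionBy (idealDiv q₁ g) then
        (idealMoebius (idealDiv q₁ g) : ℂ) * (Ideal.absNorm g : ℂ) else 0) =
      ∑ f ∈ idealDivisors q₁, (if X + Δ ∈ torsionBy f then
        (idealMoebius f : ℂ) * (Ideal.absNorm (idealDiv q₁ f) : ℂ) else 0) := by
    intro X
    rw [← sum_idealDivisors_idealDiv hq₁]
    refine Finset.sum_congr rfl fun f hf => ?_
    rw [idealDiv_idealDiv hq₁ ((mem_idealDivisors hq₁).1 hf)]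
  simp_rw [h1]
  rw [sum_primitiveFinset hq₁, Finset.sum_product]
  refine Finset.sum_congr rfl fun k _ => ?_
  simp_rw [Finset.mul_sum]
  rw [Finset.sum_comm]
  refine Finset.sum_congr rfl fun f _ => ?_
  rw [Finset.sum_filter]
  refine Finset.sum_congr rfl fun X _ => ?_
  split_ifs <;> ring

open scoped Classical in
-- For the unique solution `x`, write `ψ_{q₁}(x) = ψ_{q₁}(-δ) ψ_{q₁}(x + δ)`. In the last factor
-- only the primes of `f` contribute, and at those `x` is trivial because `k` and `f` are coprime.
-- The first factor equals `ψ_b(-δ)` by the assumption on `δ` at primes of `b` away from `q₁`.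
theorem sum_quotChar_shift_eq_psiIdeal {b q₁ k f : Ideal (𝓞 K)} {δ δ₀ : K} (hb : b ≠ ⊥)
    (hq₁ : q₁ ∣ b) (hk : k ∣ q₁) (hf : f ∣ q₁) (hδ₀ : IsLocalPart q₁ δ δ₀)
    (hδ : ∀ v : HeightOneSpectrum (𝓞 K), v.asIdeal ∣ b → ¬ v.asIdeal ∣ q₁ →
      OrdGe v (-ordDiff K v) δ)
    (hc : IsCoprime k f) (hΔ : (Submodule.Quotient.mk δ₀ : DualQuotient K) ∈ torsionBy (k * f)) :
    ∑ X ∈ torsionFinset k with X + Submodule.Quotient.mk δ₀ ∈ torsionBy f, quotChar X =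
      psiIdeal b (-δ) * psiIdeal f δ := by
  have hq₁0 := ne_bot_of_dvd hb hq₁
  have hk0 := ne_bot_of_dvd hq₁0 hk
  have hf0 := ne_bot_of_dvd hq₁0 hf
  obtain ⟨X, hX1, hX2, hX⟩ := exists_sum_quotChar_shift_eq hk0 hc hΔ
  rw [hX]
  obtain ⟨x, rfl⟩ := Submodule.Quotient.mk_surjective _ X
  rw [mk_mem_torsionBy hk0, mem_mul_different_inv_iff hk0] at hX1
  rw [← Submodule.Quotient.mk_add, mk_mem_torsionBy hf0, mem_mul_different_inv_iff hf0] at hX2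
  have h1 : ∀ v : HeightOneSpectrum (𝓞 K), ¬ v.asIdeal ∣ k → OrdGe v (-ordDiff K v) x := by
    intro v hv
    simpa [ordIdeal_eq_zero hk0 hv] using hX1 v
  have h2 : psiIdeal q₁ (x + δ) = psiIdeal f δ := by
    rw [psiIdeal_eq_of_dvd hf fun v hv hvf => ?_, psiIdeal_add hf0,
      psiIdeal_eq_one fun v hv => h1 v fun hvk => isCoprime_iff_forall_prime.1 hc v hvk hv, one_mul]
    have := hX2 v
    rw [ordIdeal_eq_zero hf0 hvf, neg_zero, zero_sub] at this
    have := this.sub (hδ₀.sub v hv)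
    rwa [add_sub_assoc, sub_sub_cancel] at this
  rw [quotChar_mk, ← psiIdeal_eq_traceChar (b := q₁) fun v hv => h1 v fun h => hv (h.trans hk),
    psiIdeal_eq_of_dvd (b := b) hq₁ fun v hv hv' => (hδ v hv hv').neg, ← h2, psiIdeal_add hq₁0]
  linear_combination -psiIdeal q₁ x * psiIdeal_neg_mul hq₁0 δ

end Evaluation

/-! ### From the exponential sum to torsion sums -/

section ExponentialSum

variable {K : Type*} [Field K] [NumberField K]

theorem modulus_mul_sup {𝔡 𝔮 : Ideal (𝓞 K)} : (𝔡 ⊔ 𝔮) * modulus 𝔡 𝔮 = 𝔮 :=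
  idealDiv_mul_cancel (Ideal.dvd_iff_le.2 le_sup_right)

theorem modulus_dvd (𝔡 𝔮 : Ideal (𝓞 K)) : modulus 𝔡 𝔮 ∣ 𝔮 :=
  Dvd.intro_left _ modulus_mul_sup

/-- The ideals `𝔡 / (𝔡, 𝔮)` and `𝔮 / (𝔡, 𝔮)` are coprime, so at a prime of the second one the gcd
has the order of `𝔡`. -/
theorem ordIdeal_of_dvd_modulus {𝔡 𝔮 : Ideal (𝓞 K)} (h𝔡 : 𝔡 ≠ ⊥) (h𝔮 : 𝔮 ≠ ⊥)
    {v : HeightOneSpectrum (𝓞 K)} (hv : v.asIdeal ∣ modulus 𝔡 𝔮) :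
    ordIdeal v 𝔮 = ordIdeal v 𝔡 + ordIdeal v (modulus 𝔡 𝔮) := by
  have hg : 𝔡 ⊔ 𝔮 ≠ ⊥ := fun h0 => h𝔡 (eq_bot_iff.2 (h0 ▸ le_sup_left))
  obtain ⟨t, ht⟩ : 𝔡 ⊔ 𝔮 ∣ 𝔡 := Ideal.dvd_iff_le.2 le_sup_left
  have ht0 : t ≠ ⊥ := ne_bot_of_dvd h𝔡 (Dvd.intro_left _ ht.symm)
  have hb0 := ne_bot_of_dvd h𝔮 (modulus_dvd 𝔡 𝔮)
  have hvt : ¬ v.asIdeal ∣ t := by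
    intro hvt
    have h1 : (𝔡 ⊔ 𝔮) * v.asIdeal ∣ 𝔡 := by
      conv_rhs => rw [ht]
      exact mul_dvd_mul_left _ hvt
    have h2 : (𝔡 ⊔ 𝔮) * v.asIdeal ∣ 𝔮 := by
      conv_rhs => rw [← modulus_mul_sup (𝔡 := 𝔡) (𝔮 := 𝔮)]
      exact mul_dvd_mul_left _ hv
    have h3 : (𝔡 ⊔ 𝔮) * v.asIdeal ∣ (𝔡 ⊔ 𝔮) * 1 := by
      rw [mul_one]
      exact Ideal.dvd_iff_le.2 (sup_le (Ideal.dvd_iff_le.1 h1) (Ideal.dvd_iff_le.1 h2))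
    exact v.prime.not_isUnit (isUnit_of_dvd_one ((mul_dvd_mul_iff_left hg).1 h3))
  have e1 := ordIdeal_mul (v := v) hg hb0
  have e2 := ordIdeal_mul (v := v) hg ht0
  rw [modulus_mul_sup] at e1
  rw [← ht, ordIdeal_eq_zero ht0 hvt] at e2
  linarith

open FractionalIdeal in
-- Multiplication by `β c²`, which generates `𝔇² 𝔮² (𝔞𝔡)⁻¹`, eliminates `𝔞` and `𝔠`: the condition
-- becomes `δ ∈ 𝔮² (𝔡 b t 𝔇)⁻¹`.
theorem mem_iff_ordGe_mul {𝔞 𝔠 : FracIdeal K} (h𝔞 : 𝔞 ≠ 0) (h𝔠 : 𝔠 ≠ 0) {𝔡 𝔮 b : Ideal (𝓞 K)}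
    (h𝔡 : 𝔡 ≠ ⊥) (h𝔮 : 𝔮 ≠ ⊥) (hb : b ≠ ⊥) {β c γ : K}
    (hβ : spanSingleton (𝓞 K)⁰ β = (𝔠 * different K) ^ 2 * (𝔞 * (𝔡 : FracIdeal K))⁻¹)
    (hc : spanSingleton (𝓞 K)⁰ c = 𝔠⁻¹ * (𝔮 : FracIdeal K)) {t : Ideal (𝓞 K)} (ht : t ≠ ⊥) :
    γ ∈ 𝔞 * ((b : FracIdeal K) * (t : FracIdeal K) * different K ^ 3)⁻¹ ↔
      ∀ v : HeightOneSpectrum (𝓞 K), OrdGe v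
        (2 * ordIdeal v 𝔮 - ordIdeal v 𝔡 - ordIdeal v b - ordIdeal v t - ordDiff K v)
        (β * c ^ 2 * γ) := by
  have hD := different_ne_zero (K := K)
  have hd' := coeIdeal_ne_zero' (K := K) h𝔡
  have hq' := coeIdeal_ne_zero' (K := K) h𝔮
  have hb' := coeIdeal_ne_zero' (K := K) hb
  have ht' := coeIdeal_ne_zero' (K := K) ht
  have he : spanSingleton (𝓞 K)⁰ (β * c ^ 2) ≠ 0 := by
    rw [← spanSingleton_mul_spanSingleton, ← spanSingleton_pow, hβ, hc]
    simp [h𝔞, h𝔠, hD, hd', hq']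
  have he0 : β * c ^ 2 ≠ 0 := spanSingleton_ne_zero_iff.1 he
  have hI : spanSingleton (𝓞 K)⁰ (β * c ^ 2) *
      (𝔞 * ((b : FracIdeal K) * (t : FracIdeal K) * different K ^ 3)⁻¹) =
      (𝔮 : FracIdeal K) ^ 2 * ((𝔡 : FracIdeal K) * (b * (t * different K)))⁻¹ := by
    rw [← spanSingleton_mul_spanSingleton, ← spanSingleton_pow, hβ, hc]
    field_simp
  rw [← mul_mem_spanSingleton_mul_iff he0, hI, mem_iff_ordGe (by positivity)]
  refine forall_congr' fun v => ?_
  have hcount : count K v ((𝔮 : FracIdeal K) ^ 2 *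
      ((𝔡 : FracIdeal K) * (b * (t * different K)))⁻¹) =
      2 * ordIdeal v 𝔮 - ordIdeal v 𝔡 - ordIdeal v b - ordIdeal v t - ordDiff K v := by
    have h1 := mul_ne_zero ht' hD
    have h2 := mul_ne_zero hb' h1
    rw [count_mul K v (pow_ne_zero 2 hq') (inv_ne_zero (mul_ne_zero hd' h2)), count_inv,
      count_mul K v hd' h2, count_mul K v hb' h1, count_mul K v ht' hD, count_pow]
    simp only [ordIdeal, ordDiff]
    push_cast
    ring
  rw [hcount]

open FractionalIdeal in
open scoped Classical in
-- Once both variables live in `K / 𝔇⁻¹`, the archimedean factor is `e(-Tr Y)`; it combines with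
-- `e(-Tr wY)`, and the sum over `Y` is a Ramanujan sum.
theorem expSum_eq {𝔞 𝔠 : FracIdeal K} (h𝔞 : 𝔞 ≠ 0) (h𝔠 : 𝔠 ≠ 0) {𝔡 𝔮 𝔮₁ : Ideal (𝓞 K)}
    (h𝔡 : 𝔡 ≠ ⊥) (h𝔮 : 𝔮 ≠ ⊥) (h𝔮₁ : 𝔮₁ ∣ modulus 𝔡 𝔮) {β c γ : K}
    (hβ : spanSingleton (𝓞 K)⁰ β = (𝔠 * different K) ^ 2 * (𝔞 * (𝔡 : FracIdeal K))⁻¹)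
    (hc : spanSingleton (𝓞 K)⁰ c = 𝔠⁻¹ * (𝔮 : FracIdeal K))
    (hδ : ∀ v : HeightOneSpectrum (𝓞 K), v.asIdeal ∣ modulus 𝔡 𝔮 →
      OrdGe v (ordIdeal v 𝔮 - 2 * ordIdeal v 𝔮₁ - ordDiff K v) (β * c ^ 2 * γ)) :
    ∃ w : DualQuotient K → 𝓞 K,
      (∀ X ∈ primitiveFinset 𝔮₁, ∃ x : K, Submodule.Quotient.mk x = X ∧
        IsMultiplier (modulus 𝔡 𝔮) 𝔮 𝔮₁ (β * c ^ 2 * γ) x (w X)) ∧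
      expSum 𝔞 𝔠 𝔡 β c γ 𝔮 𝔮₁ = ∑ X ∈ primitiveFinset 𝔮₁, quotChar X *
        ∑ k ∈ idealDivisors 𝔮, if -(1 + w X) ∈ k then
          (idealMoebius (idealDiv 𝔮 k) : ℂ) * (Ideal.absNorm k : ℂ) else 0 := by
  have hD := different_ne_zero (K := K)
  have hd' := coeIdeal_ne_zero' (K := K) h𝔡
  have hq' := coeIdeal_ne_zero' (K := K) h𝔮
  have hb := ne_bot_of_dvd h𝔮 (modulus_dvd 𝔡 𝔮)
  obtain ⟨w, hw, hkl⟩ := exists_kloosterman_eq hb h𝔮 h𝔮₁ (modulus_dvd 𝔡 𝔮) hδ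
  refine ⟨w, hw, ?_⟩
  have he : spanSingleton (𝓞 K)⁰ (β * c) ≠ 0 := by
    rw [← spanSingleton_mul_spanSingleton, hβ, hc]
    simp [h𝔞, h𝔠, hD, hd', hq']
  have he0 : β * c ≠ 0 := spanSingleton_ne_zero_iff.1 he
  have hB : 𝔞 * (𝔡 : FracIdeal K) * (𝔠 * different K)⁻¹ ≠ 0 :=
    mul_ne_zero (mul_ne_zero h𝔞 hd') (inv_ne_zero (mul_ne_zero h𝔠 hD))
  -- The scale `β c` is right because `(β c) 𝔇⁻¹ = 𝔠 𝔇 𝔮 (𝔞𝔡)⁻¹`, the modulus of the inverse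
  -- classes.
  have hbij := bijOn_invClass (e := β * c) hB h𝔮 he0 rfl (by
    rw [← spanSingleton_mul_spanSingleton, hβ, hc]
    field_simp)
  rw [expSum, finsum_mem_eq_of_bijOn _ hbij (g := fun Y => ∑ X ∈ primitiveFinset 𝔮₁,
      quotChar X * quotChar ((-(1 + w X)) • Y)) fun X hX => ?_]
  · rw [finsum_mem_coe_finset, Finset.sum_comm]
    refine Finset.sum_congr rfl fun X _ => ?_
    rw [← Finset.mul_sum, sum_primitiveFinset_quotChar_smul h𝔮]
  · have hY := (mem_primitiveFinset h𝔮).1 (hbij.mapsTo hX)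
    set z := rep (invClass X)
    have hy := (mk_mem_torsionBy h𝔮).1 (mem_torsionBy.2 hY.dvd)
    have harg : -γ * c * z = -(β * c ^ 2 * γ * (z / (β * c))) := by
      have hβ0 := left_ne_zero_of_mul he0
      have hc0 := right_ne_zero_of_mul he0
      field_simp
    rw [harg, hkl _ hy, psiInf_eq_traceChar, Finset.mul_sum]
    refine Finset.sum_congr rfl fun X' _ => ?_
    rw [neg_smul, add_smul, one_smul, neg_add, quotChar_add, ← Submodule.Quotient.mk_neg,
      quotChar_mk]
    ring

/-- This matches the torsion condition on `Δ` with the condition on `γ`. At primes of `𝔮₁` the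
exponents agree, as `n v` is the order of `𝔮` and hence that of `𝔮₁`; at other primes both sides
hold automatically. -/
theorem mk_mem_torsionBy_mul_iff {b 𝔮 𝔮₁ t : Ideal (𝓞 K)} {δ δ₀ : K} (h𝔮 : 𝔮 ≠ ⊥)
    (h𝔮₁ : 𝔮₁ ∣ b) (hbq : b ∣ 𝔮) (hcop : IsCoprime 𝔮₁ (idealDiv 𝔮 𝔮₁)) (ht : t ∣ 𝔮₁)
    (hδ₀ : IsLocalPart 𝔮₁ δ δ₀) (n : HeightOneSpectrum (𝓞 K) → ℤ)
    (hn : ∀ v : HeightOneSpectrum (𝓞 K), v.asIdeal ∣ b → n v = ordIdeal v 𝔮)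
    (hδ : ∀ v : HeightOneSpectrum (𝓞 K), ¬ v.asIdeal ∣ 𝔮₁ → OrdGe v (n v - ordDiff K v) δ) :
    (Submodule.Quotient.mk δ₀ : DualQuotient K) ∈ torsionBy t ↔
      ∀ v : HeightOneSpectrum (𝓞 K),
        OrdGe v (n v - ordIdeal v (𝔮₁ * t) - ordDiff K v) δ := by
  have hq₁q := h𝔮₁.trans hbq
  have hq₁0 := ne_bot_of_dvd h𝔮 hq₁q
  have ht0 := ne_bot_of_dvd hq₁0 ht
  rw [mk_mem_torsionBy ht0, mem_mul_different_inv_iff ht0]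
  refine forall_congr' fun v => ?_
  rw [ordIdeal_mul hq₁0 ht0]
  have ht1 := ordIdeal_nonneg v t
  by_cases hv : v.asIdeal ∣ 𝔮₁
  · have hmul := ordIdeal_mul (v := v) hq₁0 (ne_bot_of_dvd h𝔮 (idealDiv_dvd hq₁q))
    rw [idealDiv_mul_cancel hq₁q, ordIdeal_eq_zero (ne_bot_of_dvd h𝔮 (idealDiv_dvd hq₁q))
      (isCoprime_iff_forall_prime.1 hcop v hv)] at hmul
    rw [show n v - (ordIdeal v 𝔮₁ + ordIdeal v t) - ordDiff K v = -ordIdeal v t - ordDiff K v by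
      rw [hn v (hv.trans h𝔮₁)]; linarith]
    have hs := (hδ₀.sub v hv).mono (m := -ordIdeal v t - ordDiff K v) (by linarith)
    exact ⟨fun h => by simpa using h.sub hs, fun h => by simpa using h.add hs⟩
  · rw [ordIdeal_eq_zero hq₁0 hv, ordIdeal_eq_zero ht0 fun h => hv (h.trans ht)]
    exact ⟨fun _ => (hδ v hv).mono (by linarith), fun _ => (hδ₀.ordGe v hv).mono (by linarith)⟩

/-- If `f` is squarefree, some prime `v ∣ f` has `v² ∣ a`. Being coprime to `f`, the ideal `k` is
prime to `v`, so `v² ∣ a / k`. -/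
theorem idealMoebius_mul_idealMoebius_eq_zero {a k f : Ideal (𝓞 K)} (ha : a ≠ ⊥) (hk : k ∣ a)
    (hf : f ∣ a) (hc : IsCoprime k f) (h : ¬ f ∣ squarefreePart a) :
    idealMoebius (idealDiv a k) * idealMoebius f = 0 := by
  by_cases hs : Squarefree f
  · have : ∃ v : HeightOneSpectrum (𝓞 K), v.asIdeal ∣ f ∧ v.asIdeal ^ 2 ∣ a := by
      by_contra! hv
      exact h (dvd_squarefreePart ha hs fun v hvf => ⟨hvf.trans hf, hv v hvf⟩)
    obtain ⟨v, hvf, hva⟩ := this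
    rw [idealMoebius_eq_zero_of_sq_dvd v.prime (sq_dvd_idealDiv hk
      (fun hvk => isCoprime_iff_forall_prime.1 hc v hvk hvf) hva), zero_mul]
  · rw [idealMoebius_of_not_squarefree hs, mul_zero]

end ExponentialSum

end VoronoiSum
end

/-! ### Assembly of the formula -/

theorem mainTheorem12 {K : Type*} [Field K] [NumberField K]
    (𝔞 𝔠 : VoronoiSum.FracIdeal K) (h𝔞 : 𝔞 ≠ 0) (h𝔠 : 𝔠 ≠ 0)
    (𝔡 𝔮 𝔮₁ : Ideal (𝓞 K)) (h𝔡 : 𝔡 ≠ ⊥) (h𝔮 : 𝔮 ≠ ⊥)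
    (h𝔮₁ : 𝔮₁ ∣ VoronoiSum.modulus 𝔡 𝔮)
    (β c γ : K)
    (hβ : FractionalIdeal.spanSingleton (𝓞 K)⁰ β =
      (𝔠 * VoronoiSum.different K) ^ 2 * (𝔞 * (𝔡 : VoronoiSum.FracIdeal K))⁻¹)
    (hc : FractionalIdeal.spanSingleton (𝓞 K)⁰ c = 𝔠⁻¹ * (𝔮 : VoronoiSum.FracIdeal K))
    (hγ : γ ∈ 𝔞 * ((VoronoiSum.modulus 𝔡 𝔮 : VoronoiSum.FracIdeal K) *
      (𝔮₁ : VoronoiSum.FracIdeal K) ^ 2 * VoronoiSum.different K ^ 3)⁻¹) :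
    (¬ IsCoprime 𝔮₁ (VoronoiSum.idealDiv 𝔮 𝔮₁) →
      VoronoiSum.expSum 𝔞 𝔠 𝔡 β c γ 𝔮 𝔮₁ = 0) ∧
    (IsCoprime 𝔮₁ (VoronoiSum.idealDiv 𝔮 𝔮₁) →
      VoronoiSum.expSum 𝔞 𝔠 𝔡 β c γ 𝔮 𝔮₁ =
        VoronoiSum.psiIdeal (VoronoiSum.modulus 𝔡 𝔮) (-(β * c ^ 2 * γ)) *
          (VoronoiSum.idealMoebius (VoronoiSum.idealDiv 𝔮 𝔮₁) : ℂ) *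
          (Ideal.absNorm 𝔮₁ : ℂ) *
          ∑ᶠ p ∈ {p : Ideal (𝓞 K) × Ideal (𝓞 K) |
              p.1 ∣ 𝔮₁ ∧ p.2 ∣ VoronoiSum.squarefreePart 𝔮₁ ∧
              IsCoprime p.1 (VoronoiSum.idealDiv 𝔮 𝔮₁) ∧ IsCoprime p.1 p.2 ∧
              γ ∈ 𝔞 * ((VoronoiSum.modulus 𝔡 𝔮 : VoronoiSum.FracIdeal K) *
                (𝔮₁ : VoronoiSum.FracIdeal K) * (p.1 : VoronoiSum.FracIdeal K) *
                (p.2 : VoronoiSum.FracIdeal K) * VoronoiSum.different K ^ 3)⁻¹},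
            (VoronoiSum.idealMoebius (VoronoiSum.idealDiv 𝔮₁ p.1) : ℂ) *
              (VoronoiSum.idealMoebius p.2 : ℂ) / (Ideal.absNorm p.2 : ℂ) *
              VoronoiSum.psiIdeal p.2 (β * c ^ 2 * γ)) := by
  classical
  open VoronoiSum in
  have hbq := modulus_dvd 𝔡 𝔮
  have hb := ne_bot_of_dvd h𝔮 hbq
  have hq₁q := h𝔮₁.trans hbq
  have hq₁ := ne_bot_of_dvd h𝔮 hq₁q
  set b := modulus 𝔡 𝔮 with hbdef
  set δ := β * c ^ 2 * γ with hδdef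
  have hγ' : ∀ v : HeightOneSpectrum (𝓞 K), OrdGe v (2 * ordIdeal v 𝔮 - ordIdeal v 𝔡 -
      ordIdeal v b - 2 * ordIdeal v 𝔮₁ - ordDiff K v) δ := by
    rw [← FractionalIdeal.coeIdeal_pow,
      mem_iff_ordGe_mul h𝔞 h𝔠 h𝔡 h𝔮 hb hβ hc (pow_ne_zero 2 hq₁)] at hγ
    intro v
    have h := hγ v
    rwa [sq, ordIdeal_mul hq₁ hq₁, ← two_mul] at h
  have hord : ∀ v : HeightOneSpectrum (𝓞 K), v.asIdeal ∣ b →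
      2 * ordIdeal v 𝔮 - ordIdeal v 𝔡 - ordIdeal v b = ordIdeal v 𝔮 := fun v hv => by
    linarith [ordIdeal_of_dvd_modulus h𝔡 h𝔮 hv]
  have hδ : ∀ v : HeightOneSpectrum (𝓞 K), v.asIdeal ∣ b →
      OrdGe v (ordIdeal v 𝔮 - 2 * ordIdeal v 𝔮₁ - ordDiff K v) δ := fun v hv => by
    have h := hγ' v
    rwa [hord v hv] at h
  obtain ⟨w, hw, hsum⟩ := expSum_eq h𝔞 h𝔠 h𝔡 h𝔮 h𝔮₁ hβ hc hδ
  rw [hsum]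
  refine ⟨fun hcop => ?_, fun hcop => ?_⟩
  · refine Finset.sum_eq_zero fun X hX => ?_
    obtain ⟨x, -, hx⟩ := hw X hX
    rw [ramanujan_eq_zero hx h𝔮 hq₁q hcop, mul_zero]
  obtain ⟨δ₀, hδ₀⟩ := exists_isLocalPart 𝔮₁ δ
  have hinner : ∀ X ∈ primitiveFinset 𝔮₁, (quotChar X * ∑ k ∈ idealDivisors 𝔮,
      if -(1 + w X) ∈ k then (idealMoebius (idealDiv 𝔮 k) : ℂ) * (Ideal.absNorm k : ℂ) else 0) =
      (idealMoebius (idealDiv 𝔮 𝔮₁) : ℂ) * (quotChar X * ∑ g ∈ idealDivisors 𝔮₁,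
        if X + (Submodule.Quotient.mk δ₀ : DualQuotient K) ∈ torsionBy (idealDiv 𝔮₁ g) then
          (idealMoebius (idealDiv 𝔮₁ g) : ℂ) * (Ideal.absNorm g : ℂ) else 0) := by
    intro X hX
    obtain ⟨x, rfl, hx⟩ := hw X hX
    rw [ramanujan_eq_of_isCoprime hx h𝔮 hq₁q hcop, mul_left_comm]
    congr 2
    refine Finset.sum_congr rfl fun g hg => ?_
    rw [← hx.smul_mk hδ₀ h𝔮 h𝔮₁ hbq hcop hX]
    simp only [add_smul_mem_torsionBy_iff hq₁ ((mem_idealDivisors hq₁).1 hg)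
      ((mem_primitiveFinset hq₁).1 hX)]
  rw [Finset.sum_congr rfl hinner, ← Finset.mul_sum, sum_primitive_shift hq₁]
  -- These are the pairs `(𝔮₂, f)` whose shifted torsion sum need not vanish; the restriction of `f`
  -- to the square-free part is imposed afterwards.
  set S : Finset (Ideal (𝓞 K) × Ideal (𝓞 K)) :=
    (idealDivisors 𝔮₁ ×ˢ idealDivisors 𝔮₁).filter fun p => IsCoprime p.1 p.2 ∧
      (Submodule.Quotient.mk δ₀ : DualQuotient K) ∈ torsionBy (p.1 * p.2) with hS
  have hcond : ∀ p : Ideal (𝓞 K) × Ideal (𝓞 K), p.1 ∣ 𝔮₁ → p.2 ∣ 𝔮₁ → IsCoprime p.1 p.2 →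
      ((Submodule.Quotient.mk δ₀ : DualQuotient K) ∈ torsionBy (p.1 * p.2) ↔
        γ ∈ 𝔞 * ((b : FracIdeal K) * (𝔮₁ : FracIdeal K) * (p.1 : FracIdeal K) *
          (p.2 : FracIdeal K) * different K ^ 3)⁻¹) := by
    intro p h1 h2 h12
    have hp : p.1 * p.2 ∣ 𝔮₁ := h12.mul_dvd h1 h2
    have heq : (b : FracIdeal K) * (𝔮₁ : FracIdeal K) * (p.1 : FracIdeal K) *
        (p.2 : FracIdeal K) = (b : FracIdeal K) * ((𝔮₁ * (p.1 * p.2) : Ideal (𝓞 K)) :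
          FracIdeal K) := by
      rw [FractionalIdeal.coeIdeal_mul, FractionalIdeal.coeIdeal_mul]; ring
    rw [heq, mem_iff_ordGe_mul h𝔞 h𝔠 h𝔡 h𝔮 hb hβ hc (mul_ne_zero hq₁ (ne_bot_of_dvd hq₁ hp)),
      mk_mem_torsionBy_mul_iff h𝔮 h𝔮₁ hbq hcop hp hδ₀
        (fun v => 2 * ordIdeal v 𝔮 - ordIdeal v 𝔡 - ordIdeal v b) hord]
    intro v hv
    have h := hγ' v
    rwa [ordIdeal_eq_zero hq₁ hv, mul_zero, sub_zero] at h
  -- The two index sets differ only in the square-free condition on `f`: coprimality of `𝔮₂` to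
  -- `𝔮/𝔮₁` is inherited from `𝔮₁`.
  have hfin : ∀ F : Ideal (𝓞 K) × Ideal (𝓞 K) → ℂ,
      (∀ p ∈ S, ¬ p.2 ∣ squarefreePart 𝔮₁ → F p = 0) →
      ∑ᶠ p ∈ {p : Ideal (𝓞 K) × Ideal (𝓞 K) | p.1 ∣ 𝔮₁ ∧ p.2 ∣ squarefreePart 𝔮₁ ∧
        IsCoprime p.1 (idealDiv 𝔮 𝔮₁) ∧ IsCoprime p.1 p.2 ∧
        γ ∈ 𝔞 * ((b : FracIdeal K) * (𝔮₁ : FracIdeal K) * (p.1 : FracIdeal K) *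
          (p.2 : FracIdeal K) * different K ^ 3)⁻¹}, F p = ∑ p ∈ S, F p := by
    intro F hF
    refine finsum_mem_eq_sum_of_inter_support_eq F (Set.ext fun p => ?_)
    simp only [Set.mem_inter_iff, Set.mem_ofPred_eq, Finset.mem_coe, Function.mem_support]
    refine and_congr_left fun hFp => ⟨fun ⟨h1, h2, _, h4, h5⟩ => ?_, fun hp => ?_⟩
    · have h2' := h2.trans (squarefreePart_dvd hq₁)
      rw [hS, Finset.mem_filter, Finset.mem_product, mem_idealDivisors hq₁,
        mem_idealDivisors hq₁]
      exact ⟨⟨h1, h2'⟩, h4, (hcond p h1 h2' h4).2 h5⟩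
    · have hsq : p.2 ∣ squarefreePart 𝔮₁ := by
        by_contra h; exact hFp (hF p hp h)
      rw [hS, Finset.mem_filter, Finset.mem_product, mem_idealDivisors hq₁,
        mem_idealDivisors hq₁] at hp
      obtain ⟨⟨h1, h2⟩, h4, h5⟩ := hp
      exact ⟨h1, hsq, hcop.of_isCoprime_of_dvd_left h1, h4, (hcond p h1 h2 h4).1 h5⟩
  rw [hfin]
  · have hdist : ∀ p ∈ idealDivisors 𝔮₁ ×ˢ idealDivisors 𝔮₁,
        (idealMoebius (idealDiv 𝔮₁ p.1) : ℂ) * (idealMoebius p.2 : ℂ) *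
          (Ideal.absNorm (idealDiv 𝔮₁ p.2) : ℂ) *
          ∑ X ∈ torsionFinset p.1 with
            X + (Submodule.Quotient.mk δ₀ : DualQuotient K) ∈ torsionBy p.2, quotChar X =
        if IsCoprime p.1 p.2 ∧
            (Submodule.Quotient.mk δ₀ : DualQuotient K) ∈ torsionBy (p.1 * p.2) then
          psiIdeal b (-δ) * (Ideal.absNorm 𝔮₁ : ℂ) * ((idealMoebius (idealDiv 𝔮₁ p.1) : ℂ) *
            (idealMoebius p.2 : ℂ) / (Ideal.absNorm p.2 : ℂ) * psiIdeal p.2 δ) else 0 := by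
      intro p hp
      rw [Finset.mem_product, mem_idealDivisors hq₁, mem_idealDivisors hq₁] at hp
      split_ifs with h
      · rw [sum_quotChar_shift_eq_psiIdeal hb h𝔮₁ hp.1 hp.2 hδ₀ (fun v hv hv' => ?_) h.1 h.2]
        -- Multiplicativity of the norm turns `N(𝔮₁/f)` into `N(𝔮₁)/N(f)`.
        · have hN : (Ideal.absNorm 𝔮₁ : ℂ) =
              (Ideal.absNorm p.2 : ℂ) * (Ideal.absNorm (idealDiv 𝔮₁ p.2) : ℂ) := by
            rw [← Nat.cast_mul, ← map_mul, idealDiv_mul_cancel hp.2]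
          have hN0 : (Ideal.absNorm p.2 : ℂ) ≠ 0 := by
            rw [Nat.cast_ne_zero, Ne, Ideal.absNorm_eq_zero_iff]
            exact ne_bot_of_dvd hq₁ hp.2
          rw [hN]
          field_simp
        · refine (hδ v hv).mono ?_
          rw [ordIdeal_eq_zero hq₁ hv']
          linarith [ordIdeal_nonneg v 𝔮]
      · rw [sum_quotChar_shift_eq_zero (ne_bot_of_dvd hq₁ hp.1) _ h, mul_zero]
    rw [Finset.sum_congr rfl hdist, ← Finset.sum_filter, ← hS, ← Finset.mul_sum]
    ring
  · intro p hp hsq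
    rw [hS, Finset.mem_filter, Finset.mem_product, mem_idealDivisors hq₁,
      mem_idealDivisors hq₁] at hp
    have h := idealMoebius_mul_idealMoebius_eq_zero hq₁ hp.1.1 hp.1.2 hp.2.1 hsq
    rw [← Int.cast_mul, h]
    simp
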